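/- Let $N\ge 1$ and $B\ge 0$ be integers with $4B\le N$. There are $K$ independent messages $W_1,\dots,W_K$, each uniform on $\mathcal{F}^L$ for a finite alphabet $\mathcal{F}$ with $|\mathcal F|\ge 2$ and some $L\ge 1$. They are encoded, possibly with private randomness, into the storages $S_1,\dots,S_N$ of $N$ servers. The servers also hold masking variables $\hat Z_1,\dots,\hat Z_N$ of an arbitrary joint law, independent of the messages and storages. To retrieve $W_\theta$, a user sends queries $Q_n^{[\theta]}$, $n\in[N]$, generated independently of the messages, storages and masking variables. All these alphabets and the answer alphabets $\mathcal{A}_n$ are finite and are chosen by the scheme. There is an unknown set $\mathcal{B}\subset[N]$ of Byzantine servers, $|\mathcal{B}|\le B$. An honest server $n\notin\mathcal{B}$ answers with $A_n^{[\theta]}\in\mathcal A_n$, a fixed function of $S_n,Q_n^{[\theta]},\hat Z_n$. A Byzantine server $n\in\mathcal B$ answers with an arbitrary $\mathcal A_n$-valued function of $S_{\mathcal B},Q_{\mathcal B}^{[\theta]},\hat Z_{\mathcal B}$ and $\gamma_n$, where $(\gamma_n)_{n\in\mathcal B}$ are arbitrary discrete random variables, possibly dependent on each other, but independent of everything else.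 The scheme is required to satisfy the following, for every set $\mathcal B\subset[N]$ with $|\mathcal{B}|\le B$, every behaviour of the servers in $\mathcal B$ and every $\theta\in[K]$: - *Correctness.* The user computes $W_\theta$ without error from $\theta$, $Q_{[N]}^{[\theta]}$ and $A_{[N]}^{[\theta]}$, by a decoder that depends neither on $\mathcal B$ nor on the behaviour. - *Security.* $I(S_{\mathcal B};W_{[K]})=0$ and $I(A_{\mathcal B}^{[\theta]};W_{[K]})=0$. - *User privacy.* $I(Q_{\mathcal B}^{[\theta]};\theta)=0$, where here $\theta$ is uniform on $[K]$. - *Symmetric privacy.* $I(W_{[K]\setminus\{\theta\}};A_{[N]}^{[\theta]},Q_{[N]}^{[\theta]})=0$. A rate $R\ge0$ is achievable if there are $\mathcal F$, $L$ and such a scheme with $R\le L/\sum_{n=1}^N H(A_n^{[\theta]})$ for every $\theta$, every such $\mathcal B$ and every behaviour of the servers in $\mathcal B$, entropies being taken to the base $|\mathcal F|$. Let $C_{BSPIR}(B,N,K)$ be the supremum of the achievable rates ($0$ if there are none). Then $$C_{BSPIR}(B,N,\infty)=\lim_{K\to\infty}C_{BSPIR}(B,N,K)=1-\frac{4B}{N}.$$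 -/

import Mathlib

open Filter Topology
open scoped ENNReal NNReal

noncomputable section

namespace BSPIR

/-- Shannon entropy (in nats) of the random variable `X` with values in a finite alphabet, defined on
the discrete probability space `(Ω, p)`. -/
def entropy {Ω α : Type} [Fintype α] (p : PMF Ω) (X : Ω → α) : ℝ :=
  ∑ x, Real.negMulLog ((p.map X) x).toReal

/-- Mutual information `I(X;Y) = H(X) + H(Y) - H(X,Y)`. -/
def mutualInfo {Ω α β : Type} [Fintype α] [Fintype β] (p : PMF Ω) (X : Ω → α) (Y : Ω → β) : ℝ :=
  entropy p X + entropy p Y - entropy p (fun ω => (X ω, Y ω))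

/-- The data of a retrieval scheme with `N` servers and `K` messages. No privacy, security or
correctness property is built in. -/
structure Scheme (N K : ℕ) where
  /-- the alphabet of the message symbols -/
  Symb : Type
  [symbFintype : Fintype Symb]
  [symbNontrivial : Nontrivial Symb]
  /-- the length of each message -/
  L : ℕ
  L_pos : 0 < L
  /-- the storage alphabet of each server -/
  Sto : Fin N → Type
  [stoFintype : ∀ n, Fintype (Sto n)]
  /-- the alphabet of the share of the masking randomness held by each server -/
  Msk : Fin N → Type
  [mskFintype : ∀ n, Fintype (Msk n)]
  /-- the query alphabet of each server -/
  Qry : Fin N → Type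
  [qryFintype : ∀ n, Fintype (Qry n)]
  /-- the answer alphabet of each server -/
  Ans : Fin N → Type
  [ansFintype : ∀ n, Fintype (Ans n)]
  /-- the (randomized) encoding of the messages into the storages of all servers -/
  stoLaw : (Fin K → Fin L → Symb) → PMF (∀ n, Sto n)
  /-- the joint law of the masking variables of all servers -/
  mskLaw : PMF (∀ n, Msk n)
  /-- the joint law of the queries to all servers, when the message `θ` is required -/
  qryLaw : Fin K → PMF (∀ n, Qry n)
  /-- the truthful answer of a server: a function of its storage, query and masking variable -/
  answer : ∀ n, Sto n → Qry n → Msk n → Ans n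
  /-- the decoder of the user; it knows `θ`, the queries and the answers, but neither the set of
  Byzantine servers nor what they do -/
  decode : Fin K → (∀ n, Qry n) → (∀ n, Ans n) → (Fin L → Symb)

attribute [instance] Scheme.symbFintype Scheme.symbNontrivial Scheme.stoFintype
  Scheme.mskFintype Scheme.qryFintype Scheme.ansFintype

variable {N K : ℕ}

/-- A Byzantine behaviour: a set `byz` of at most `B` servers, a random variable `γ` of arbitrary
law, and for each server in `byz` an answer that is an arbitrary function of the storages, queries and
masking variables of all servers in `byz` and of `γ`. (Arbitrarily dependent individual variables
`γ n` are the components of one shared `γ`.) -/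
structure Adversary (S : Scheme N K) (B : ℕ) where
  byz : Finset (Fin N)
  card_le : byz.card ≤ B
  Gam : Type
  gamLaw : PMF Gam
  forge : ∀ n : byz, (∀ m : byz, S.Sto m) → (∀ m : byz, S.Qry m) → (∀ m : byz, S.Msk m) →
    Gam → S.Ans n

/-- One realization of all random variables of the system. -/
structure Outcome (S : Scheme N K) (Gam : Type) where
  msg : Fin K → Fin S.L → S.Symb
  sto : ∀ n, S.Sto n
  msk : ∀ n, S.Msk n
  qry : ∀ n, S.Qry n
  gam : Gam

namespace Scheme

/-- The joint law of the messages and the storages; the messages are independent and uniform. -/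
def storageJoint (S : Scheme N K) : PMF ((Fin K → Fin S.L → S.Symb) × (∀ n, S.Sto n)) :=
  (PMF.uniformOfFintype (Fin K → Fin S.L → S.Symb)).bind fun w => (S.stoLaw w).map fun s => (w, s)

/-- The joint law of the required index, which is uniform, and the queries. -/
def queryJoint [NeZero K] (S : Scheme N K) : PMF (Fin K × (∀ n, S.Qry n)) :=
  (PMF.uniformOfFintype (Fin K)).bind fun θ => (S.qryLaw θ).map fun q => (θ, q)

/-- The law of the whole system when the message `θ` is required: the pair (messages, storages), the
masking variables, the queries and the variable `γ` of the Byzantine servers are independent. -/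
def law (S : Scheme N K) {B : ℕ} (θ : Fin K) (a : Adversary S B) : PMF (Outcome S a.Gam) :=
  S.storageJoint.bind fun ws => S.mskLaw.bind fun z => (S.qryLaw θ).bind fun q =>
    a.gamLaw.map fun g => ⟨ws.1, ws.2, z, q, g⟩

/-- The answers that the user receives. -/
def answers (S : Scheme N K) {B : ℕ} (a : Adversary S B) (ω : Outcome S a.Gam) :
    ∀ n, S.Ans n := fun n =>
  if h : n ∈ a.byz then
    a.forge ⟨n, h⟩ (fun m => ω.sto m) (fun m => ω.qry m) (fun m => ω.msk m) ω.gam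
  else S.answer n (ω.sto n) (ω.qry n) (ω.msk n)

/-- The required message is decoded without error, whatever the Byzantine servers do. -/
def Correct (S : Scheme N K) (B : ℕ) : Prop :=
  ∀ (θ : Fin K) (a : Adversary S B), ∀ ω ∈ (S.law θ a).support,
    S.decode θ ω.qry (S.answers a ω) = ω.msg θ

/-- The storages of any `B` servers reveal nothing about the messages:
`I(S_𝓑 ; W_[K]) = 0`. -/
def StorageSecure (S : Scheme N K) (B : ℕ) : Prop :=
  ∀ b : Finset (Fin N), b.card ≤ B →
    mutualInfo S.storageJoint (fun x => fun n : b => x.2 n) (fun x => x.1) = 0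

/-- The answers of the Byzantine servers reveal nothing about the messages:
`I(A_𝓑 ; W_[K]) = 0`. -/
def ByzantineSecure (S : Scheme N K) (B : ℕ) : Prop :=
  ∀ (θ : Fin K) (a : Adversary S B),
    mutualInfo (S.law θ a) (fun ω => fun n : a.byz => S.answers a ω n) (fun ω => ω.msg) = 0

/-- The queries to any `B` servers reveal nothing about the required index:
`I(Q_𝓑 ; θ) = 0`. -/
def UserPrivate [NeZero K] (S : Scheme N K) (B : ℕ) : Prop :=
  ∀ b : Finset (Fin N), b.card ≤ B →
    mutualInfo S.queryJoint (fun x => fun n : b => x.2 n) (fun x => x.1) = 0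

/-- The user learns nothing about the other messages, whatever the Byzantine servers do:
`I(W_{[K] \ θ} ; A_[N], Q_[N]) = 0`. -/
def SymmetricPrivate (S : Scheme N K) (B : ℕ) : Prop :=
  ∀ (θ : Fin K) (a : Adversary S B),
    mutualInfo (S.law θ a) (fun ω => fun k : {k : Fin K // k ≠ θ} => ω.msg k)
      (fun ω => (S.answers a ω, ω.qry)) = 0

/-- A symmetric private information retrieval scheme that withstands `B` Byzantine servers. -/
structure IsBSPIR [NeZero K] (S : Scheme N K) (B : ℕ) : Prop where
  correct : S.Correct B
  storageSecure : S.StorageSecure B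
  byzantineSecure : S.ByzantineSecure B
  userPrivate : S.UserPrivate B
  symmetricPrivate : S.SymmetricPrivate B

/-- The total download `∑ n, H(A_n)`, measured in message symbols. -/
def download (S : Scheme N K) {B : ℕ} (θ : Fin K) (a : Adversary S B) : ℝ :=
  (∑ n, entropy (S.law θ a) (fun ω => S.answers a ω n)) / Real.log (Fintype.card S.Symb)

end Scheme

/-- The rate `R` is achievable with `N` servers, `B` of them Byzantine, and `K` messages: some scheme
has `R ≤ L / ∑ n, H(A_n)`, whatever the Byzantine servers do. -/
def Achievable (N B K : ℕ) [NeZero K] (R : ℝ≥0) : Prop :=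
  ∃ S : Scheme N K, S.IsBSPIR B ∧
    ∀ (θ : Fin K) (a : Adversary S B), (R : ℝ) * S.download θ a ≤ S.L

/-- The capacity: the supremum of the achievable rates (over all schemes, all message lengths and all
alphabets). -/
def capacity (N B K : ℕ) [NeZero K] : ℝ≥0∞ :=
  ⨆ (R : ℝ≥0) (_ : Achievable N B K R), (R : ℝ≥0∞)

end BSPIR

end

/-! For every `K ≥ 2` the capacity already equals `1 - 4B/N`, so the limit is that of an eventually
constant sequence.

Converse. Let `Y` be a set of `N - 4B` servers and split its complement into `X`, `T`, `M`, `M'` of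
size `B`. By correctness, two worlds whose truthful answers agree off `M ∪ M'` have the same
required message, since either set may be the lying one (`Correct.msg_eq`). The storages and masks
of `X`, together with the answers of `T`, say nothing about `W_θ`: when another message is
retrieved, symmetric privacy hides `W_θ` even from a coalition `X` that leaks its data through its
answers (`SymmetricPrivate.independent_sideInfo`), and user privacy makes the queries to `T`
compatible with both indices. What `X` holds does not depend on the query, so nothing is asked of
the joint query to `X ∪ T`. Hence the answers of `Y` carry the entropy of a whole message
(`IsBSPIR.length_le`), and averaging over `Y` bounds the rate.

Achievability. Over a large prime field, storages and queries are Shamir shares of degree at most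
`B`, and the answers are values of one polynomial of degree below `L + 2B` that takes the symbols of
`W_θ` at `L = N - 4B` nodes. A random multiple of the nodal polynomial masks everything else. Since
`N = L + 4B`, `B` errors are correctable, and `N` symbols are downloaded for `L` message symbols.
Every privacy condition follows from an injection of the random coins (`independent_of_injections`).
-/

open Filter Topology
open scoped ENNReal NNReal

noncomputable section

namespace BSPIR

open Real InformationTheory

/-! ### Entropy, mutual information and independence. -/

section Entropy

variable {Ω α β γ : Type}

/-- The probability that `X` takes the value `x`, as a real number. -/
def pmass (p : PMF Ω) (X : Ω → α) (x : α) : ℝ := (p.map X x).toReal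

theorem map_apply_eq_toOuterMeasure (p : PMF Ω) (X : Ω → α) (x : α) :
    p.map X x = p.toOuterMeasure {ω | X ω = x} := by
  rw [← PMF.toOuterMeasure_apply_singleton, PMF.toOuterMeasure_map_apply]
  rfl

theorem map_congr_support (p : PMF Ω) {X Y : Ω → α} (h : ∀ ω ∈ p.support, X ω = Y ω) :
    p.map X = p.map Y := by
  ext x
  rw [PMF.map_apply, PMF.map_apply]
  refine tsum_congr fun ω => ?_
  by_cases hω : ω ∈ p.support
  · rw [h ω hω]
  · rw [(PMF.apply_eq_zero_iff p ω).2 hω]; simp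

theorem entropy_congr_support [Fintype α] (p : PMF Ω) {X Y : Ω → α}
    (h : ∀ ω ∈ p.support, X ω = Y ω) : entropy p X = entropy p Y := by
  rw [entropy, entropy, map_congr_support p h]

theorem pmass_nonneg (p : PMF Ω) (X : Ω → α) (x : α) : 0 ≤ pmass p X x := ENNReal.toReal_nonneg

theorem pmass_comp [Fintype α] [DecidableEq β] (p : PMF Ω) (X : Ω → α) (f : α → β) (y : β) :
    pmass p (fun ω => f (X ω)) y = ∑ x with f x = y, pmass p X x := by
  have : p.map (fun ω => f (X ω)) = (p.map X).map f := by rw [PMF.map_comp]; rfl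
  rw [pmass, this, PMF.map_apply, tsum_fintype, Finset.sum_filter, ENNReal.toReal_sum]
  · refine Finset.sum_congr rfl fun x _ => ?_
    by_cases h : f x = y
    · simp [h, pmass]
    · simp [h, Ne.symm h]
  · intro x _
    split_ifs
    · exact PMF.apply_ne_top _ _
    · simp

theorem sum_pmass [Fintype α] (p : PMF Ω) (X : Ω → α) : ∑ x, pmass p X x = 1 := by
  have := (p.map X).tsum_coe
  rw [tsum_fintype] at this
  simp only [pmass]
  rw [← ENNReal.toReal_sum (fun x _ => PMF.apply_ne_top _ _), this, ENNReal.toReal_one]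

theorem pmass_snd [Fintype α] [Fintype β] (p : PMF Ω) (X : Ω → α) (Y : Ω → β) (y : β) :
    pmass p Y y = ∑ x, pmass p (fun ω => (X ω, Y ω)) (x, y) := by
  classical
  rw [show pmass p Y y = pmass p (fun ω => Prod.snd (X ω, Y ω)) y from rfl, pmass_comp]
  refine (Finset.sum_bij (fun x _ => (x, y)) ?_ ?_ ?_ ?_).symm <;> simp

theorem pmass_fst [Fintype α] [Fintype β] (p : PMF Ω) (X : Ω → α) (Y : Ω → β) (x : α) :
    pmass p X x = ∑ y, pmass p (fun ω => (X ω, Y ω)) (x, y) := by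
  classical
  rw [show pmass p X x = pmass p (fun ω => Prod.fst (X ω, Y ω)) x from rfl, pmass_comp]
  refine (Finset.sum_bij (fun y _ => (x, y)) ?_ ?_ ?_ ?_).symm <;> simp

theorem negMulLog_sum_le (s : Finset α) (m : α → ℝ) (hm : ∀ x, 0 ≤ m x) :
    negMulLog (∑ x ∈ s, m x) ≤ ∑ x ∈ s, negMulLog (m x) := by
  rw [negMulLog, neg_mul, Finset.sum_mul, ← Finset.sum_neg_distrib]
  refine Finset.sum_le_sum fun x hx => ?_
  rw [negMulLog, neg_mul]
  rcases (hm x).eq_or_lt with h | h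
  · simp [← h]
  · exact neg_le_neg (mul_le_mul_of_nonneg_left
      (log_le_log h (Finset.single_le_sum (fun y _ => hm y) hx)) h.le)

theorem entropy_comp_le [Fintype α] [Fintype β] (p : PMF Ω) (X : Ω → α) (f : α → β) :
    entropy p (fun ω => f (X ω)) ≤ entropy p X := by
  classical
  calc entropy p (fun ω => f (X ω)) = ∑ y, negMulLog (∑ x with f x = y, pmass p X x) :=
        Finset.sum_congr rfl fun y _ => congrArg negMulLog (pmass_comp p X f y)
    _ ≤ ∑ y, ∑ x with f x = y, negMulLog (pmass p X x) :=
        Finset.sum_le_sum fun y _ => negMulLog_sum_le _ _ (pmass_nonneg p X)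
    _ = entropy p X := Finset.sum_fiberwise _ _ _

/-- This is the Kullback–Leibler divergence of the joint law from the product law. With `klFun`
every summand is nonnegative, which gives both nonnegativity and the equality case. -/
theorem mutualInfo_eq_sum [Fintype α] [Fintype β] (p : PMF Ω) (X : Ω → α) (Y : Ω → β) :
    mutualInfo p X Y = ∑ z : α × β, pmass p X z.1 * pmass p Y z.2 *
      klFun (pmass p (fun ω => (X ω, Y ω)) z / (pmass p X z.1 * pmass p Y z.2)) := by
  set P := pmass p (fun ω => (X ω, Y ω)) with hP
  have hP0 : ∀ z, 0 ≤ P z := pmass_nonneg _ _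
  have hfst : ∀ x, pmass p X x = ∑ y, P (x, y) := pmass_fst p X Y
  have hsnd : ∀ y, pmass p Y y = ∑ x, P (x, y) := pmass_snd p X Y
  have hX : entropy p X = ∑ z : α × β, -(P z * log (pmass p X z.1)) := by
    rw [Fintype.sum_prod_type]
    refine Finset.sum_congr rfl fun x _ => ?_
    dsimp only
    rw [Finset.sum_neg_distrib, ← Finset.sum_mul, ← hfst, ← neg_mul]
    rfl
  have hY : entropy p Y = ∑ z : α × β, -(P z * log (pmass p Y z.2)) := by
    rw [Fintype.sum_prod_type_right]
    refine Finset.sum_congr rfl fun y _ => ?_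
    dsimp only
    rw [Finset.sum_neg_distrib, ← Finset.sum_mul, ← hsnd, ← neg_mul]
    rfl
  have hXY : entropy p (fun ω => (X ω, Y ω)) = ∑ z, -(P z * log (P z)) :=
    Finset.sum_congr rfl fun z _ => by rw [← neg_mul]; rfl
  have hone : ∑ z : α × β, (P z - pmass p X z.1 * pmass p Y z.2) = 0 := by
    rw [Finset.sum_sub_distrib, hP, sum_pmass, Fintype.sum_prod_type]
    simp only
    rw [← Finset.sum_mul_sum, sum_pmass, sum_pmass]
    norm_num
  -- The vanishing sum `hone` is subtracted to supply the linear terms of `klFun`, so that the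
  -- identity holds term by term.
  rw [mutualInfo, hX, hY, hXY, ← Finset.sum_add_distrib, ← Finset.sum_sub_distrib, ← sub_zero
    (∑ z : α × β, _), ← hone, ← Finset.sum_sub_distrib]
  refine Finset.sum_congr rfl fun z _ => ?_
  rcases (hP0 z).eq_or_lt with h | h
  · simp [← h, klFun]
  · have h1 : 0 < pmass p X z.1 := h.trans_le <| by
      rw [hfst]; exact Finset.single_le_sum (f := fun y => P (z.1, y)) (fun y _ => hP0 _)
        (Finset.mem_univ z.2)
    have h2 : 0 < pmass p Y z.2 := h.trans_le <| by
      rw [hsnd]; exact Finset.single_le_sum (f := fun x => P (x, z.2)) (fun x _ => hP0 _)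
        (Finset.mem_univ z.1)
    rw [klFun, log_div h.ne' (mul_pos h1 h2).ne', log_mul h1.ne' h2.ne']
    field_simp
    ring

theorem mutualInfo_nonneg [Fintype α] [Fintype β] (p : PMF Ω) (X : Ω → α) (Y : Ω → β) :
    0 ≤ mutualInfo p X Y := by
  rw [mutualInfo_eq_sum]
  have h1 := pmass_nonneg p X
  have h2 := pmass_nonneg p Y
  exact Finset.sum_nonneg fun z _ => mul_nonneg (mul_nonneg (h1 _) (h2 _))
    (klFun_nonneg (div_nonneg (pmass_nonneg _ _ _) (mul_nonneg (h1 _) (h2 _))))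

/-- Independence of two discrete random variables. -/
def Independent (p : PMF Ω) (X : Ω → α) (Y : Ω → β) : Prop :=
  ∀ x y, p.toOuterMeasure {ω | X ω = x ∧ Y ω = y} =
    p.toOuterMeasure {ω | X ω = x} * p.toOuterMeasure {ω | Y ω = y}

theorem independent_iff_pmass (p : PMF Ω) (X : Ω → α) (Y : Ω → β) :
    Independent p X Y ↔
      ∀ z : α × β, pmass p (fun ω => (X ω, Y ω)) z = pmass p X z.1 * pmass p Y z.2 := by
  rw [Prod.forall]
  refine forall₂_congr fun x y => ?_
  rw [pmass, pmass, pmass, ← ENNReal.toReal_mul, ENNReal.toReal_eq_toReal_iff' (PMF.apply_ne_top _ _)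
    (ENNReal.mul_ne_top (PMF.apply_ne_top _ _) (PMF.apply_ne_top _ _)),
    map_apply_eq_toOuterMeasure, map_apply_eq_toOuterMeasure, map_apply_eq_toOuterMeasure]
  simp only [Prod.mk.injEq]

theorem mutualInfo_eq_zero_iff [Fintype α] [Fintype β] (p : PMF Ω) (X : Ω → α) (Y : Ω → β) :
    mutualInfo p X Y = 0 ↔ Independent p X Y := by
  have h1 := pmass_nonneg p X
  have h2 := pmass_nonneg p Y
  have h3 := pmass_nonneg p (fun ω => (X ω, Y ω))
  rw [mutualInfo_eq_sum, independent_iff_pmass, Finset.sum_eq_zero_iff_of_nonneg]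
  · refine ⟨fun h z => ?_, fun h z _ => ?_⟩
    · rcases mul_eq_zero.1 (h z (Finset.mem_univ z)) with h0 | h0
      · rw [h0]
        rcases mul_eq_zero.1 h0 with h0 | h0
        · rw [pmass_fst p X Y, Finset.sum_eq_zero_iff_of_nonneg fun y _ => h3 _] at h0
          exact h0 z.2 (Finset.mem_univ _)
        · rw [pmass_snd p X Y, Finset.sum_eq_zero_iff_of_nonneg fun y _ => h3 _] at h0
          exact h0 z.1 (Finset.mem_univ _)
      · rw [klFun_eq_zero_iff (div_nonneg (h3 _) (mul_nonneg (h1 _) (h2 _)))] at h0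
        exact eq_of_div_eq_one h0
    · rw [h z]
      by_cases h0 : pmass p X z.1 * pmass p Y z.2 = 0
      · rw [h0, zero_mul]
      · rw [div_self h0, klFun_one, mul_zero]
  · exact fun z _ => mul_nonneg (mul_nonneg (h1 _) (h2 _))
      (klFun_nonneg (div_nonneg (h3 _) (mul_nonneg (h1 _) (h2 _))))

theorem entropy_pair_le [Fintype α] [Fintype β] (p : PMF Ω) (X : Ω → α) (Y : Ω → β) :
    entropy p (fun ω => (X ω, Y ω)) ≤ entropy p X + entropy p Y := by
  have := mutualInfo_nonneg p X Y
  rw [mutualInfo] at this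
  linarith

theorem entropy_pi_le {ι : Type} [DecidableEq ι] {A : ι → Type} [∀ i, Fintype (A i)] (p : PMF Ω)
    (X : ∀ i, Ω → A i) (s : Finset ι) :
    entropy p (fun ω => fun i : s => X i ω) ≤ ∑ i ∈ s, entropy p (X i) := by
  induction s using Finset.induction_on with
  | empty =>
    have h : ∀ x, pmass p (fun ω => fun i : (∅ : Finset ι) => X i ω) x = 1 := fun x => by
      have := sum_pmass p (fun ω => fun i : (∅ : Finset ι) => X i ω)
      rwa [Fintype.sum_subsingleton _ x] at this
    rw [Finset.sum_empty]
    refine (Finset.sum_eq_zero fun x _ => ?_).le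
    exact (congrArg negMulLog (h x)).trans negMulLog_one
  | insert i s hi ih =>
    rw [Finset.sum_insert hi]
    let f : A i × (∀ j : s, A j) → ∀ j : (insert i s : Finset ι), A j := fun y j =>
      if h : j.1 = i then cast (congrArg A h.symm) y.1 else y.2 ⟨j, Finset.mem_of_mem_insert_of_ne j.2 h⟩
    have hf : (fun ω => fun j : (insert i s : Finset ι) => X j ω) =
        fun ω => f (X i ω, fun j : s => X j ω) := by
      funext ω ⟨j, hj⟩
      by_cases h : j = i
      · subst h; simp [f]
      · simp [f, h]
    rw [hf]
    have := entropy_comp_le p (fun ω => (X i ω, fun j : s => X j ω)) f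
    have := entropy_pair_le p (X i) (fun ω => fun j : s => X j ω)
    linarith

theorem entropy_le_log_card [Fintype α] (p : PMF Ω) (X : Ω → α) :
    entropy p X ≤ log (Fintype.card α) := by
  have hne : Nonempty α := ⟨X p.support_nonempty.some⟩
  have hn : (0 : ℝ) < Fintype.card α := by exact_mod_cast Fintype.card_pos
  have key : ∀ x, (Fintype.card α : ℝ)⁻¹ - pmass p X x + pmass p X x * log (Fintype.card α) -
      negMulLog (pmass p X x) = (Fintype.card α : ℝ)⁻¹ * klFun (Fintype.card α * pmass p X x) := by
    intro x
    rcases (pmass_nonneg p X x).eq_or_lt with h | h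
    · simp [← h, klFun]
    · rw [klFun, log_mul hn.ne' h.ne', negMulLog]
      field_simp
      ring
  have h : 0 ≤ ∑ x, ((Fintype.card α : ℝ)⁻¹ - pmass p X x + pmass p X x * log (Fintype.card α) -
      negMulLog (pmass p X x)) := by
    simp_rw [key]
    exact Finset.sum_nonneg fun x _ => mul_nonneg (by positivity)
      (klFun_nonneg (mul_nonneg hn.le (pmass_nonneg _ _ _)))
  rw [Finset.sum_sub_distrib, Finset.sum_add_distrib, Finset.sum_sub_distrib, ← Finset.sum_mul,
    sum_pmass] at h
  simp only [Finset.sum_const, Finset.card_univ, nsmul_eq_mul, mul_inv_cancel₀ hn.ne', one_mul] at h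
  have : entropy p X = ∑ x, negMulLog (pmass p X x) := rfl
  linarith

theorem entropy_of_map_eq_uniform [Fintype α] [Nonempty α] (p : PMF Ω) (X : Ω → α)
    (h : p.map X = PMF.uniformOfFintype α) : entropy p X = log (Fintype.card α) := by
  have hn : (0 : ℝ) < Fintype.card α := by exact_mod_cast Fintype.card_pos
  rw [entropy, h]
  simp only [PMF.uniformOfFintype_apply, ENNReal.toReal_inv, ENNReal.toReal_natCast, negMulLog,
    log_inv, Finset.sum_const, Finset.card_univ, nsmul_eq_mul]
  field_simp

/-- H(W) + H(C) = H(W,C) ≤ H(A,C) ≤ H(A) + H(C): the middle step holds because `A` and `C` together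
determine `W`. -/
theorem entropy_le_of_independent [Fintype α] [Fintype β] [Fintype γ] (p : PMF Ω) (W : Ω → α)
    (C : Ω → β) (A : Ω → γ) (hind : Independent p W C)
    (hdet : ∀ ω ∈ p.support, ∀ ω' ∈ p.support, C ω = C ω' → A ω = A ω' → W ω = W ω') :
    entropy p W ≤ entropy p A := by
  classical
  have hne : Nonempty α := ⟨W p.support_nonempty.some⟩
  let g : γ × β → α × β := fun z =>
    (if h : ∃ ω ∈ p.support, A ω = z.1 ∧ C ω = z.2 then W h.choose else Classical.arbitrary α, z.2)
  have hg : ∀ ω ∈ p.support, (W ω, C ω) = g (A ω, C ω) := by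
    intro ω hω
    have h : ∃ ω' ∈ p.support, A ω' = A ω ∧ C ω' = C ω := ⟨ω, hω, rfl, rfl⟩
    have h' := h.choose_spec
    simp only [g, dif_pos h]
    rw [hdet ω hω h.choose h'.1 h'.2.2.symm h'.2.1.symm]
  have h0 := (mutualInfo_eq_zero_iff p W C).2 hind
  rw [mutualInfo, entropy_congr_support p hg] at h0
  have h1 := entropy_comp_le p (fun ω => (A ω, C ω)) g
  have h2 := entropy_pair_le p A C
  linarith

end Entropy

/-! ### Calculus of independence, binds and uniform laws. -/

section Independence

variable {Ω α β γ δ : Type}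

theorem Independent.comp [Fintype α] [Fintype β] {p : PMF Ω} {X : Ω → α} {Y : Ω → β}
    (h : Independent p X Y) (f : α → γ) (g : β → δ) :
    Independent p (fun ω => f (X ω)) (fun ω => g (Y ω)) := by
  classical
  rw [independent_iff_pmass] at h ⊢
  rintro ⟨c, d⟩
  have h1 := pmass_comp p (fun ω => (X ω, Y ω)) (fun z => (f z.1, g z.2)) (c, d)
  have h2 : (Finset.univ.filter fun z : α × β => (f z.1, g z.2) = (c, d)) =
      (Finset.univ.filter fun x => f x = c) ×ˢ (Finset.univ.filter fun y => g y = d) := by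
    ext z; simp
  rw [h2, Finset.sum_product] at h1
  rw [h1, pmass_comp p X f c, pmass_comp p Y g d, Finset.sum_mul_sum]
  exact Finset.sum_congr rfl fun x _ => Finset.sum_congr rfl fun y _ => h (x, y)

theorem toOuterMeasure_bind_const (p : PMF α) (κ : α → PMF Ω) (E : Set Ω) (c : ℝ≥0∞)
    (h : ∀ a ∈ p.support, (κ a).toOuterMeasure E = c) : (p.bind κ).toOuterMeasure E = c := by
  rw [PMF.toOuterMeasure_bind_apply]
  calc ∑' a, p a * (κ a).toOuterMeasure E = ∑' a, p a * c := by
        refine tsum_congr fun a => ?_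
        by_cases ha : a ∈ p.support
        · rw [h a ha]
        · rw [(PMF.apply_eq_zero_iff p a).2 ha, zero_mul, zero_mul]
    _ = c := by rw [ENNReal.tsum_mul_right, p.tsum_coe, one_mul]

theorem toOuterMeasure_bind_single (p : PMF α) (κ : α → PMF Ω) (E : Set Ω) (a : α)
    (h : ∀ a', a' ≠ a → (κ a').toOuterMeasure E = 0) :
    (p.bind κ).toOuterMeasure E = p a * (κ a).toOuterMeasure E := by
  rw [PMF.toOuterMeasure_bind_apply, tsum_eq_single a fun a' ha => by rw [h a' ha, mul_zero]]

theorem uniform_map_le [Fintype α] [Nonempty α] (X : α → β) (x x' : β) (Φ : α → α)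
    (hΦ : Function.Injective Φ) (h : ∀ a, X a = x → X (Φ a) = x') :
    (PMF.uniformOfFintype α).map X x ≤ (PMF.uniformOfFintype α).map X x' := by
  classical
  rw [PMF.map_apply, PMF.map_apply]
  refine le_trans (ENNReal.tsum_le_tsum fun a => ?_) (ENNReal.tsum_comp_le_tsum_of_injective hΦ _)
  by_cases ha : x = X a
  · simp [ha, h a ha.symm]
  · simp [ha]

theorem eq_uniform_of_le [Fintype α] [Nonempty α] (p : PMF α) (h : ∀ x x', p x ≤ p x') :
    p = PMF.uniformOfFintype α := by
  ext x
  have h1 : ∀ x', p x' = p x := fun x' => le_antisymm (h _ _) (h _ _)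
  have h2 := p.tsum_coe
  rw [tsum_fintype, Finset.sum_congr rfl fun x' _ => h1 x', Finset.sum_const, Finset.card_univ,
    nsmul_eq_mul, mul_comm] at h2
  rw [PMF.uniformOfFintype_apply, ENNReal.eq_inv_of_mul_eq_one_left h2]

theorem uniform_map_eval {ι : Type} [Fintype ι] [DecidableEq ι] [Fintype α] [Nonempty α] (i : ι) :
    (PMF.uniformOfFintype (ι → α)).map (fun w => w i) = PMF.uniformOfFintype α := by
  classical
  refine eq_uniform_of_le _ fun x x' => uniform_map_le _ x x' (fun w j => Equiv.swap x x' (w j))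
    (fun w w' h => ?_) fun w hw => by simp [hw]
  funext j
  exact (Equiv.swap x x').injective (congrFun h j)

end Independence

variable {N K : ℕ}

/-! ### The law of the system and deterministic adversaries. -/

namespace Scheme

variable (S : Scheme N K) {B : ℕ}

/-- Messages, storages and masking variables. -/
abbrev Source : Type := (Fin K → Fin S.L → S.Symb) × (∀ n, S.Sto n) × (∀ n, S.Msk n)

/-- The joint law of the messages, the storages and the masking variables. -/
def sourceLaw : PMF S.Source :=
  S.storageJoint.bind fun ws => S.mskLaw.map fun z => (ws.1, ws.2, z)

/-- Drawing the queries before everything else allows conditioning on a fixed query while the source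
law stays the same. -/
theorem law_eq (θ : Fin K) (a : Adversary S B) :
    S.law θ a = (S.qryLaw θ).bind fun q => S.sourceLaw.bind fun x =>
      a.gamLaw.map fun g => ⟨x.1, x.2.1, x.2.2, q, g⟩ := by
  rw [law, sourceLaw]
  simp only [PMF.bind_bind, PMF.bind_map, Function.comp_def]
  rw [PMF.bind_comm (S.qryLaw θ)]
  congr 1; funext ws
  rw [PMF.bind_comm]

theorem sourceLaw_map_msg :
    S.sourceLaw.map (fun x => x.1) = PMF.uniformOfFintype (Fin K → Fin S.L → S.Symb) := by
  simp only [sourceLaw, storageJoint, PMF.map_bind, PMF.bind_bind, PMF.bind_map, PMF.map_comp,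
    Function.comp_def]
  refine (congrArg _ (funext fun w => ?_)).trans (PMF.bind_pure _)
  rw [PMF.bind_const]
  exact PMF.map_const _ _

/-- The adversary that uses no randomness. -/
abbrev detAdversary (byz : Finset (Fin N)) (h : byz.card ≤ B)
    (forge : ∀ n : byz, (∀ m : byz, S.Sto m) → (∀ m : byz, S.Qry m) → (∀ m : byz, S.Msk m) →
      S.Ans n) : Adversary S B where
  byz := byz
  card_le := h
  Gam := Unit
  gamLaw := PMF.pure ()
  forge n s q z _ := forge n s q z

/-- The outcome without adversarial randomness. -/
def outcome (q : ∀ n, S.Qry n) (x : S.Source) : Outcome S Unit := ⟨x.1, x.2.1, x.2.2, q, ()⟩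

/-- The law of the system when the adversary uses no randomness. -/
def detLaw (θ : Fin K) : PMF (Outcome S Unit) :=
  (S.qryLaw θ).bind fun q => S.sourceLaw.map (S.outcome q)

theorem law_detAdversary (θ : Fin K) (byz : Finset (Fin N)) (h : byz.card ≤ B)
    (forge : ∀ n : byz, (∀ m : byz, S.Sto m) → (∀ m : byz, S.Qry m) → (∀ m : byz, S.Msk m) →
      S.Ans n) : S.law θ (S.detAdversary byz h forge) = S.detLaw θ := by
  rw [law_eq]
  show ((S.qryLaw θ).bind fun q => S.sourceLaw.bind fun x =>
      (PMF.pure ()).map fun g => (⟨x.1, x.2.1, x.2.2, q, g⟩ : Outcome S Unit)) = _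
  simp only [PMF.pure_map, detLaw]
  rfl

theorem mem_support_detLaw (θ : Fin K) (ω : Outcome S Unit) :
    ω ∈ (S.detLaw θ).support ↔
      ω.qry ∈ (S.qryLaw θ).support ∧ (ω.msg, ω.sto, ω.msk) ∈ S.sourceLaw.support := by
  obtain ⟨w, s, z, q, ⟨⟩⟩ := ω
  rw [detLaw, PMF.mem_support_bind_iff]
  simp only [PMF.mem_support_map_iff]
  constructor
  · rintro ⟨q', hq', x, hx, h⟩
    rw [outcome, Outcome.mk.injEq] at h
    obtain ⟨rfl, rfl, rfl, rfl, -⟩ := h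
    exact ⟨hq', hx⟩
  · rintro ⟨hq, hx⟩
    exact ⟨q, hq, _, hx, rfl⟩

/-- An event that forces the query to be `q` meets only one branch of the bind. -/
theorem detLaw_toOuterMeasure_qry (θ : Fin K) (q : ∀ n, S.Qry n) (E : Outcome S Unit → Prop)
    (hE : ∀ ω, E ω → ω.qry = q) :
    (S.detLaw θ).toOuterMeasure {ω | E ω} =
      S.qryLaw θ q * S.sourceLaw.toOuterMeasure {x | E (S.outcome q x)} := by
  rw [detLaw, toOuterMeasure_bind_single _ _ _ q]
  · rw [PMF.toOuterMeasure_map_apply]; rfl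
  · intro q' hq'
    rw [PMF.toOuterMeasure_map_apply]
    have : S.outcome q' ⁻¹' {ω | E ω} = ∅ := Set.eq_empty_of_forall_notMem fun x h => hq' (hE _ h)
    rw [this]
    exact S.sourceLaw.toOuterMeasure.empty

theorem detLaw_toOuterMeasure_msg (θ : Fin K) (E : (Fin K → Fin S.L → S.Symb) → Prop) :
    (S.detLaw θ).toOuterMeasure {ω | E ω.msg} = S.sourceLaw.toOuterMeasure {x | E x.1} := by
  rw [detLaw]
  refine toOuterMeasure_bind_const _ _ _ _ fun q _ => ?_
  rw [PMF.toOuterMeasure_map_apply]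
  rfl

theorem entropy_msg (θ θ' : Fin K) :
    entropy (S.detLaw θ) (fun ω => ω.msg θ') = S.L * log (Fintype.card S.Symb) := by
  rw [entropy_of_map_eq_uniform, Fintype.card_fun, Fintype.card_fin, Nat.cast_pow, log_pow]
  rw [← uniform_map_eval θ', ← S.sourceLaw_map_msg, PMF.map_comp]
  refine PMF.ext fun w => ?_
  rw [map_apply_eq_toOuterMeasure, map_apply_eq_toOuterMeasure]
  exact S.detLaw_toOuterMeasure_msg θ (fun m => m θ' = w)

/-- The truthful answers. -/
def truth (q : ∀ n, S.Qry n) (x : S.Source) (n : Fin N) : S.Ans n :=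
  S.answer n (x.2.1 n) (q n) (x.2.2 n)

theorem answers_detAdversary_of_notMem (byz : Finset (Fin N)) (h : byz.card ≤ B)
    (forge : ∀ n : byz, (∀ m : byz, S.Sto m) → (∀ m : byz, S.Qry m) → (∀ m : byz, S.Msk m) →
      S.Ans n) (q : ∀ n, S.Qry n) (x : S.Source) {n : Fin N} (hn : n ∉ byz) :
    S.answers (S.detAdversary byz h forge) (S.outcome q x) n = S.truth q x n := dif_neg hn

theorem answers_detAdversary_of_mem (byz : Finset (Fin N)) (h : byz.card ≤ B)
    (forge : ∀ n : byz, (∀ m : byz, S.Sto m) → (∀ m : byz, S.Qry m) → (∀ m : byz, S.Msk m) →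
      S.Ans n) (q : ∀ n, S.Qry n) (x : S.Source) {n : Fin N} (hn : n ∈ byz) :
    S.answers (S.detAdversary byz h forge) (S.outcome q x) n =
      forge ⟨n, hn⟩ (fun m => x.2.1 m) (fun m => q m) (fun m => x.2.2 m) := dif_pos hn

/-! ### Converse: any `N - 4B` servers must answer with the entropy of a message. -/

variable {S}

/-- Two disjoint sets of at most `B` servers can be blamed for the disagreement of two worlds, so that the
truthful answers of the other servers determine the required message. -/
theorem Correct.msg_eq (hS : S.Correct B) {θ : Fin K} {q : ∀ n, S.Qry n}
    (hq : q ∈ (S.qryLaw θ).support) {x x' : S.Source} (hx : x ∈ S.sourceLaw.support)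
    (hx' : x' ∈ S.sourceLaw.support) (M M' : Finset (Fin N)) (hM : M.card ≤ B) (hM' : M'.card ≤ B)
    (hd : Disjoint M M') (h : ∀ n, n ∉ M → n ∉ M' → S.truth q x n = S.truth q x' n) : x.1 θ = x'.1 θ := by
  -- In world `x` the servers of `M` pretend to be in world `x'`, and in world `x'` those of `M'`
  -- pretend to be in world `x`. The user receives the same answers in both.
  let a := S.detAdversary M hM fun n _ _ _ => S.truth q x' n
  let a' := S.detAdversary M' hM' fun n _ _ _ => S.truth q x n
  have h1 : S.decode θ q (S.answers a (S.outcome q x)) = x.1 θ := by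
    refine hS θ a (S.outcome q x) ?_
    rw [law_detAdversary]
    exact (S.mem_support_detLaw θ _).2 ⟨hq, hx⟩
  have h2 : S.decode θ q (S.answers a' (S.outcome q x')) = x'.1 θ := by
    refine hS θ a' (S.outcome q x') ?_
    rw [law_detAdversary]
    exact (S.mem_support_detLaw θ _).2 ⟨hq, hx'⟩
  rw [← h1, ← h2]
  congr 1
  funext n
  by_cases hn : n ∈ M <;> by_cases hn' : n ∈ M'
  · exact absurd hn' (Finset.disjoint_left.1 hd hn)
  · rw [answers_detAdversary_of_mem _ _ _ _ _ _ hn,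
      answers_detAdversary_of_notMem _ _ _ _ _ _ hn']
  · rw [answers_detAdversary_of_notMem _ _ _ _ _ _ hn,
      answers_detAdversary_of_mem _ _ _ _ _ _ hn']
  · rw [answers_detAdversary_of_notMem _ _ _ _ _ _ hn,
      answers_detAdversary_of_notMem _ _ _ _ _ _ hn', h n hn hn']

end Scheme

namespace Scheme

variable {S : Scheme N K} {B : ℕ}

/-- The messages, storages and masking variables of an outcome. -/
def _root_.BSPIR.Outcome.source {G : Type} (ω : Outcome S G) : S.Source := (ω.msg, ω.sto, ω.msk)

/-- The source is independent of the query, so independence for each possible query lifts to the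
pair (query, side information). -/
theorem independent_detLaw (θ θ' : Fin K) {U : Type} (side : (∀ n, S.Qry n) → S.Source → U)
    (h : ∀ q ∈ (S.qryLaw θ).support,
      Independent S.sourceLaw (fun x => x.1 θ') (fun x => side q x)) :
    Independent (S.detLaw θ) (fun ω => ω.msg θ') (fun ω => (ω.qry, side ω.qry ω.source)) := by
  rintro w ⟨q, u⟩
  rw [S.detLaw_toOuterMeasure_qry θ q
      (fun ω => ω.msg θ' = w ∧ (ω.qry, side ω.qry ω.source) = (q, u))
      fun ω hω => congrArg Prod.fst hω.2,
    S.detLaw_toOuterMeasure_qry θ q (fun ω => (ω.qry, side ω.qry ω.source) = (q, u))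
      fun ω hω => congrArg Prod.fst hω,
    S.detLaw_toOuterMeasure_msg θ (fun m => m θ' = w)]
  by_cases hq : q ∈ (S.qryLaw θ).support
  · have := h q hq w u
    simp only [outcome, Outcome.source, Prod.mk.injEq, true_and, Prod.mk.eta]
    rw [this, mul_left_comm]
  · rw [(PMF.apply_eq_zero_iff _ _).2 hq]
    simp

/-- The storages and masking variables of the servers in `X`, and the truthful answers of the servers
in `T`. -/
def sideInfo (S : Scheme N K) (X T : Finset (Fin N)) (q : ∀ n, S.Qry n) (x : S.Source) :
    ((∀ n : X, S.Sto n) × (∀ n : X, S.Msk n)) × (∀ n : T, S.Ans n) :=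
  ((fun n => x.2.1 n, fun n => x.2.2 n), fun n => S.truth q x n)

/-- A Byzantine server that can send two different answers can test for any value of the storages and
masking variables of its coalition, so symmetric privacy extends to these. -/
theorem SymmetricPrivate.independent_sideInfo (hS : S.SymmetricPrivate B) {θ θ' : Fin K}
    (hne : θ' ≠ θ) {X T : Finset (Fin N)} (hX : X.card ≤ B) (hXT : Disjoint X T) {n₀ : Fin N}
    (hn₀ : n₀ ∈ X) {a₀ a₁ : S.Ans n₀} (ha : a₁ ≠ a₀) {q : ∀ n, S.Qry n}
    (hq : q ∈ (S.qryLaw θ).support) :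
    Independent S.sourceLaw (fun x => x.1 θ') (fun x => S.sideInfo X T q x) := by
  classical
  rintro w ⟨⟨s, z⟩, v⟩
  obtain ⟨x₀, -⟩ := S.sourceLaw.support_nonempty
  -- Server `n₀` reports whether the coalition's data equal `(s, z)`; the other members send fixed
  -- irrelevant answers.
  let forge : ∀ n : X, (∀ m : X, S.Sto m) → (∀ m : X, S.Qry m) → (∀ m : X, S.Msk m) → S.Ans n :=
    fun n s' _ z' => Function.update (β := S.Ans) (S.truth q x₀) n₀
      (if (s', z') = (s, z) then a₀ else a₁) n
  have h0 := hS θ (S.detAdversary X hX forge)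
  rw [mutualInfo_eq_zero_iff, law_detAdversary] at h0
  have h1 := h0.comp (fun m => m ⟨θ', hne⟩)
    (fun y : (∀ n, S.Ans n) × (∀ n, S.Qry n) => (y.2, (fun n : T => y.1 n), decide (y.1 n₀ = a₀)))
    w (q, v, true)
  have h2 : ∀ x : S.Source,
      (q, (fun n : T => S.answers (S.detAdversary X hX forge) (S.outcome q x) n),
        decide (S.answers (S.detAdversary X hX forge) (S.outcome q x) n₀ = a₀)) = (q, v, true) ↔
      S.sideInfo X T q x = ((s, z), v) := by
    intro x
    have h3 : (fun n : T => S.answers (S.detAdversary X hX forge) (S.outcome q x) n) =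
        fun n : T => S.truth q x n := funext fun n =>
      S.answers_detAdversary_of_notMem _ _ _ _ _ (Finset.disjoint_right.1 hXT n.2)
    have h4 : S.answers (S.detAdversary X hX forge) (S.outcome q x) n₀ =
        if ((fun n : X => x.2.1 n), (fun n : X => x.2.2 n)) = (s, z) then a₀ else a₁ := by
      rw [S.answers_detAdversary_of_mem _ _ _ _ _ hn₀]
      exact Function.update_self ..
    rw [h3, h4, sideInfo]
    split_ifs with h <;> simp [h, ha]
  dsimp only at h1
  rw [S.detLaw_toOuterMeasure_qry θ q
      (fun ω => ω.msg θ' = w ∧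
        (ω.qry, (fun n : T => S.answers (S.detAdversary X hX forge) ω n),
          decide (S.answers (S.detAdversary X hX forge) ω n₀ = a₀)) = (q, v, true))
      fun ω hω => congrArg Prod.fst hω.2,
    S.detLaw_toOuterMeasure_qry θ q
      (fun ω => (ω.qry, (fun n : T => S.answers (S.detAdversary X hX forge) ω n),
          decide (S.answers (S.detAdversary X hX forge) ω n₀ = a₀)) = (q, v, true))
      fun ω hω => congrArg Prod.fst hω,
    -- Both sides carry the factor `S.qryLaw θ q`, which is nonzero on the support and cancels.
    S.detLaw_toOuterMeasure_msg θ (fun m => m θ' = w), mul_left_comm,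
    ENNReal.mul_right_inj ((PMF.mem_support_iff _ _).1 hq) (PMF.apply_ne_top _ _)] at h1
  simp only [show ∀ x, (S.outcome q x).qry = q from fun _ => rfl, h2] at h1
  exact h1

/-- By independence, the event that the index is `θ'` and the queries to `T` are those of `q` has a
product of positive probabilities, hence is not null. -/
theorem UserPrivate.exists_query [NeZero K] (hS : S.UserPrivate B) {T : Finset (Fin N)}
    (hT : T.card ≤ B) (θ θ' : Fin K) {q : ∀ n, S.Qry n} (hq : q ∈ (S.qryLaw θ).support) :
    ∃ q' ∈ (S.qryLaw θ').support, ∀ n ∈ T, q' n = q n := by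
  have hmem : ∀ y : Fin K × (∀ n, S.Qry n),
      y ∈ S.queryJoint.support ↔ y.2 ∈ (S.qryLaw y.1).support := by
    rintro ⟨i, r⟩
    simp [queryJoint]
  have h := hS T hT
  rw [mutualInfo_eq_zero_iff] at h
  have h1 := h (fun n : T => q n) θ'
  have h2 : S.queryJoint.toOuterMeasure {y | (fun n : T => y.2 n) = fun n : T => q n} ≠ 0 := by
    rw [Ne, PMF.toOuterMeasure_apply_eq_zero_iff]
    exact fun hd => Set.disjoint_left.1 hd ((hmem (θ, q)).2 hq) rfl
  have h3 : S.queryJoint.toOuterMeasure {y | y.1 = θ'} ≠ 0 := by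
    rw [Ne, PMF.toOuterMeasure_apply_eq_zero_iff]
    obtain ⟨r, hr⟩ := (S.qryLaw θ').support_nonempty
    exact fun hd => Set.disjoint_left.1 hd ((hmem (θ', r)).2 hr) rfl
  have h4 := mul_ne_zero h2 h3
  rw [← h1, Ne, PMF.toOuterMeasure_apply_eq_zero_iff, Set.not_disjoint_iff] at h4
  obtain ⟨⟨i, r⟩, hy, hr, rfl⟩ := h4
  exact ⟨r, (hmem _).1 hy, fun n hn => congrFun hr ⟨n, hn⟩⟩

theorem mem_support_of_mem_detLaw {θ : Fin K} {ω : Outcome S Unit}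
    (h : ω ∈ (S.detLaw θ).support) :
    ω.qry ∈ (S.qryLaw θ).support ∧ ω.source ∈ S.sourceLaw.support :=
  (S.mem_support_detLaw θ ω).1 h

/-- The answers of any `N - 4B` servers have at least the entropy of a message. -/
theorem IsBSPIR.length_le [NeZero K] (hS : S.IsBSPIR B) {θ θ' : Fin K} (hne : θ ≠ θ')
    (Y : Finset (Fin N)) (hY : Y.card + 4 * B = N) :
    S.L * log (Fintype.card S.Symb) ≤
      ∑ n ∈ Y, entropy (S.detLaw θ) (fun ω => S.truth ω.qry ω.source n) := by
  classical
  refine le_trans ?_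
    (entropy_pi_le (S.detLaw θ) (fun n (ω : Outcome S Unit) => S.truth ω.qry ω.source n) Y)
  rw [← S.entropy_msg θ θ]
  -- The test needs a server outside `Y` with two possible answers. If there is none, the answers
  -- outside `Y` are constant and those of `Y` decode alone.
  by_cases htriv : ∀ n ∉ Y, Subsingleton (S.Ans n)
  · refine entropy_le_of_independent _ _ (fun ω => (ω.qry, ())) _
      (independent_detLaw θ θ (fun _ _ => ()) fun q _ w u => ?_) ?_
    · have : S.sourceLaw.toOuterMeasure Set.univ = 1 := by
        rw [PMF.toOuterMeasure_apply_eq_one_iff]; exact Set.subset_univ _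
      simp [this]
    · intro ω hω ω' hω' hC hA
      have hq : ω.qry = ω'.qry := congrArg Prod.fst hC
      obtain ⟨h1, h2⟩ := mem_support_of_mem_detLaw hω
      obtain ⟨-, h3⟩ := mem_support_of_mem_detLaw hω'
      refine hS.correct.msg_eq h1 h2 h3 ∅ ∅ (by simp) (by simp) (by simp) fun n _ _ => ?_
      by_cases hn : n ∈ Y
      · have := congrFun hA ⟨n, hn⟩
        dsimp only at this
        rw [this, hq]
      · exact (htriv n hn).elim _ _
  push Not at htriv
  obtain ⟨n₀, hn₀, hnt⟩ := htriv
  obtain ⟨a₀, a₁, ha⟩ := hnt.exists_pair_ne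
  have hB : 0 < B := by
    by_contra hB
    have : Y = Finset.univ := Finset.eq_univ_of_card _ (by simp; omega)
    exact hn₀ (this ▸ Finset.mem_univ _)
  have hYc : Yᶜ.card = 4 * B := by rw [Finset.card_compl, Fintype.card_fin]; omega
  -- The complement of `Y` is cut into four blocks of size `B`: `X` containing `n₀`, then `T`, `M`
  -- and the rest.
  obtain ⟨X, hX1, hX2, hX3⟩ := Finset.exists_subsuperset_card_eq (s := {n₀}) (t := Yᶜ) (n := B)
    (by simpa using hn₀) (by rw [Finset.card_singleton]; exact hB) (by omega)
  have hXc : (Yᶜ \ X).card = 3 * B := by rw [Finset.card_sdiff_of_subset hX2]; omega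
  obtain ⟨T, hT1, hT2⟩ := Finset.exists_subset_card_eq (s := Yᶜ \ X) (n := B) (by omega)
  have hTc : ((Yᶜ \ X) \ T).card = 2 * B := by rw [Finset.card_sdiff_of_subset hT1]; omega
  obtain ⟨M, hM1, hM2⟩ := Finset.exists_subset_card_eq (s := (Yᶜ \ X) \ T) (n := B) (by omega)
  have hMc : (((Yᶜ \ X) \ T) \ M).card = B := by rw [Finset.card_sdiff_of_subset hM1]; omega
  refine entropy_le_of_independent _ _ (fun ω => (ω.qry, S.sideInfo X T ω.qry ω.source)) _
    (independent_detLaw θ θ (S.sideInfo X T) fun q hq => ?_) ?_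
  -- Symmetric privacy protects `W_θ` only while `θ'` is retrieved, so the query is replaced by one
  -- for `θ'` that agrees with it on `T`; the side information does not change.
  · obtain ⟨q', hq', hqq⟩ := hS.userPrivate.exists_query hT2.le θ θ' hq
    have h := hS.symmetricPrivate.independent_sideInfo hne hX3.le
      (Finset.disjoint_left.2 fun n hn hn' => (Finset.mem_sdiff.1 (hT1 hn')).2 hn)
      (hX1 (Finset.mem_singleton_self _)) ha.symm hq'
    have : S.sideInfo X T q' = S.sideInfo X T q := by
      funext x
      simp only [sideInfo, truth, Prod.mk.injEq, true_and]
      funext n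
      rw [hqq n n.2]
    rwa [this] at h
  · intro ω hω ω' hω' hC hA
    have hq : ω.qry = ω'.qry := congrArg Prod.fst hC
    have hside : S.sideInfo X T ω.qry ω.source = S.sideInfo X T ω'.qry ω'.source :=
      congrArg Prod.snd hC
    simp only [sideInfo, Prod.mk.injEq] at hside
    obtain ⟨h1, h2⟩ := mem_support_of_mem_detLaw hω
    obtain ⟨-, h3⟩ := mem_support_of_mem_detLaw hω'
    refine hS.correct.msg_eq h1 h2 h3 M (((Yᶜ \ X) \ T) \ M) hM2.le hMc.le
      Finset.disjoint_sdiff fun n hn hn' => ?_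
    by_cases hnY : n ∈ Y
    · have := congrFun hA ⟨n, hnY⟩
      dsimp only at this
      rw [this, hq]
    by_cases hnX : n ∈ X
    · have e1 := congrFun hside.1.1 ⟨n, hnX⟩
      have e2 := congrFun hside.1.2 ⟨n, hnX⟩
      dsimp only at e1 e2
      rw [truth, truth, e1, e2]
    by_cases hnT : n ∈ T
    · have := congrFun hside.2 ⟨n, hnT⟩
      dsimp only at this
      rw [this, hq]
    · simp_all

/-- The download when all servers are honest. -/
theorem download_honest (θ : Fin K) (h : (∅ : Finset (Fin N)).card ≤ B) :
    S.download θ (S.detAdversary ∅ h fun n => absurd n.2 (Finset.notMem_empty _)) *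
      log (Fintype.card S.Symb) =
      ∑ n, entropy (S.detLaw θ) (fun ω => S.truth ω.qry ω.source n) := by
  have hlog : log (Fintype.card S.Symb) ≠ 0 :=
    (log_pos (by exact_mod_cast Fintype.one_lt_card)).ne'
  rw [download, div_mul_cancel₀ _ hlog, law_detAdversary]
  rfl

/-- Averaging a lower bound for the sums over all sets of `m` servers. -/
theorem mul_le_mul_sum_of_forall_card (hN : 0 < N) (m : ℕ) (hm : m ≤ N) (h : Fin N → ℝ) (c : ℝ)
    (hc : ∀ Y : Finset (Fin N), Y.card = m → c ≤ ∑ n ∈ Y, h n) : N * c ≤ m * ∑ n, h n := by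
  have : NeZero N := ⟨hN.ne'⟩
  obtain ⟨J, -, hJ⟩ := Finset.exists_subset_card_eq (s := (Finset.univ : Finset (Fin N))) (n := m)
    (by simpa using hm)
  calc (N : ℝ) * c = ∑ _i : Fin N, c := by simp
    -- The `N` cyclic translates of one `m`-set cover each server exactly `m` times.
    _ ≤ ∑ i : Fin N, ∑ j ∈ J, h (j + i) := Finset.sum_le_sum fun i _ => by
        refine (hc (J.map (Equiv.addRight i).toEmbedding) (by simpa using hJ)).trans_eq ?_
        simp
    _ = ∑ j ∈ J, ∑ i : Fin N, h (j + i) := Finset.sum_comm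
    _ = ∑ _j ∈ J, ∑ i, h i :=
        Finset.sum_congr rfl fun j _ => Equiv.sum_comp (Equiv.addLeft j) h
    _ = m * ∑ n, h n := by rw [Finset.sum_const, hJ, nsmul_eq_mul]

end Scheme

theorem Achievable.le [NeZero K] {B : ℕ} {R : ℝ≥0} (hR : Achievable N B K R) (hN : 0 < N)
    (hB : 4 * B ≤ N) (hK : 1 < K) : (R : ℝ) ≤ 1 - 4 * (B : ℝ) / N := by
  obtain ⟨S, hS, hrate⟩ := hR
  let θ : Fin K := ⟨0, by omega⟩
  let θ' : Fin K := ⟨1, hK⟩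
  have hne : θ ≠ θ' := by simp [θ, θ', Fin.ext_iff]
  have h := Scheme.mul_le_mul_sum_of_forall_card hN (N - 4 * B) (by omega)
    (fun n => entropy (S.detLaw θ) (fun ω => S.truth ω.qry ω.source n))
    (S.L * log (Fintype.card S.Symb)) fun Y hY => hS.length_le hne Y (by omega)
  have hD := hrate θ (S.detAdversary ∅ (by simp) fun n => absurd n.2 (Finset.notMem_empty _))
  rw [← Scheme.download_honest (B := B) θ (by simp)] at h
  set D := S.download θ (B := B)
    (S.detAdversary ∅ (by simp) fun n => absurd n.2 (Finset.notMem_empty _))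
  have hlog : 0 < log (Fintype.card S.Symb) := log_pos (by exact_mod_cast Fintype.one_lt_card)
  have hNL : (N : ℝ) * S.L ≤ (N - 4 * B) * D := by
    rw [Nat.cast_sub hB] at h
    push_cast at h
    rw [← mul_assoc, ← mul_assoc] at h
    exact le_of_mul_le_mul_right h hlog
  have hN' : (0 : ℝ) < N := by exact_mod_cast hN
  have hL : (0 : ℝ) < S.L := by exact_mod_cast S.L_pos
  have hB' : (0 : ℝ) ≤ N - 4 * B := by
    have : ((4 * B : ℕ) : ℝ) ≤ N := by exact_mod_cast hB
    push_cast at this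
    linarith
  -- A nonpositive `D` would contradict `0 < N * L ≤ (N - 4B) * D`.
  have hDpos : 0 < D := by
    by_contra hD'
    nlinarith [mul_pos hN' hL]
  have : N * (R : ℝ) ≤ N - 4 * B := by
    refine le_of_mul_le_mul_right ?_ hDpos
    nlinarith
  rw [one_sub_div hN'.ne', le_div_iff₀ hN']
  linarith

/-! ### Independence from symmetries of uniform randomness. -/

section Uniform

variable {Ω A G α β γ : Type}

theorem Independent.symm {p : PMF Ω} {X : Ω → α} {Y : Ω → β} (h : Independent p X Y) :
    Independent p Y X := fun y x => by
  rw [mul_comm, ← h x y]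
  simp only [and_comm]

/-- Successive independent uniform draws merge into one uniform coin, the form that
`independent_of_injections` requires. -/
theorem uniform_bind_prod [Fintype α] [Nonempty α] [Fintype β] [Nonempty β]
    (κ : α → β → PMF γ) :
    ((PMF.uniformOfFintype α).bind fun a => (PMF.uniformOfFintype β).bind (κ a)) =
      (PMF.uniformOfFintype (α × β)).bind fun x => κ x.1 x.2 := by
  refine PMF.ext fun c => ?_
  simp only [PMF.bind_apply, PMF.uniformOfFintype_apply, Fintype.card_prod, Nat.cast_mul]
  rw [ENNReal.tsum_prod']
  refine tsum_congr fun a => ?_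
  rw [← ENNReal.tsum_mul_left]
  refine tsum_congr fun b => ?_
  rw [ENNReal.mul_inv (Or.inr (ENNReal.natCast_ne_top _)) (Or.inl (ENNReal.natCast_ne_top _)),
    mul_assoc]

/-- If injections of the uniform randomness carry each value of `X` to every other one and preserve
`Y`, then `X` and `Y` are independent. -/
theorem independent_of_injections [Fintype A] [Nonempty A] [Fintype α] [Fintype β] (gam : PMF G)
    (out : A → G → Ω) (X : Ω → α) (Y : Ω → β) (X' : A → α) (hX : ∀ a g, X (out a g) = X' a)
    (h : ∀ x x', ∃ Φ : A → A, Function.Injective Φ ∧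
      ∀ a, X' a = x → X' (Φ a) = x' ∧ ∀ g, Y (out (Φ a) g) = Y (out a g)) :
    Independent ((PMF.uniformOfFintype A).bind fun a => gam.map (out a)) X Y := by
  set p := (PMF.uniformOfFintype A).bind fun a => gam.map (out a) with hp
  have hle : ∀ x x' y, p.map (fun ω => (X ω, Y ω)) (x, y) ≤ p.map (fun ω => (X ω, Y ω)) (x', y) := by
    intro x x' y
    obtain ⟨Φ, hΦ, hΦ'⟩ := h x x'
    rw [map_apply_eq_toOuterMeasure, map_apply_eq_toOuterMeasure, hp,
      PMF.toOuterMeasure_bind_apply, PMF.toOuterMeasure_bind_apply]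
    refine le_trans (ENNReal.tsum_le_tsum fun a => ?_) (ENNReal.tsum_comp_le_tsum_of_injective hΦ _)
    rw [PMF.uniformOfFintype_apply, PMF.uniformOfFintype_apply, PMF.toOuterMeasure_map_apply,
      PMF.toOuterMeasure_map_apply]
    refine mul_le_mul_right (MeasureTheory.OuterMeasure.mono _ fun g hg => ?_) _
    simp only [Set.mem_preimage, Set.mem_ofPred_eq, Prod.mk.injEq] at hg ⊢
    rw [hX] at hg ⊢
    obtain ⟨h1, h2⟩ := hΦ' a hg.1
    exact ⟨h1, (h2 g).trans hg.2⟩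
  -- Injections in both directions make the joint mass independent of the value of `X`; so `X` is
  -- uniform and the joint law factors.
  have hconst : ∀ x x' y, pmass p (fun ω => (X ω, Y ω)) (x, y) =
      pmass p (fun ω => (X ω, Y ω)) (x', y) := fun x x' y =>
    congrArg ENNReal.toReal (le_antisymm (hle x x' y) (hle x' x y))
  rw [independent_iff_pmass]
  rintro ⟨x, y⟩
  have h1 : ∀ x', pmass p X x' = pmass p X x := fun x' => by
    rw [pmass_fst p X Y, pmass_fst p X Y]
    exact Finset.sum_congr rfl fun y _ => hconst x' x y
  have h2 := sum_pmass p X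
  rw [Finset.sum_congr rfl fun x' _ => h1 x', Finset.sum_const, nsmul_eq_mul] at h2
  have h3 : pmass p Y y = (Finset.univ : Finset α).card * pmass p (fun ω => (X ω, Y ω)) (x, y) := by
    rw [pmass_snd p X Y, Finset.sum_congr rfl fun x' _ => hconst x' x y, Finset.sum_const,
      nsmul_eq_mul]
  dsimp only
  rw [h3, ← mul_assoc, mul_comm (pmass p X x), h2, one_mul]

end Uniform

/-- A change of coins that leaves the coalition's view and the honest truthful answers fixed is
invisible to the user, whatever is forged. -/
theorem answers_congr {N K B : ℕ} {S : Scheme N K} (a : Adversary S B) (ω ω' : Outcome S a.Gam)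
    (hgam : ω.gam = ω'.gam) (hqry : ω.qry = ω'.qry) (hsto : ∀ n ∈ a.byz, ω.sto n = ω'.sto n)
    (hmsk : ∀ n ∈ a.byz, ω.msk n = ω'.msk n) (n : Fin N)
    (hans : n ∉ a.byz → S.answer n (ω.sto n) (ω.qry n) (ω.msk n) =
      S.answer n (ω'.sto n) (ω'.qry n) (ω'.msk n)) : S.answers a ω n = S.answers a ω' n := by
  by_cases hn : n ∈ a.byz
  · have h1 : (fun m : a.byz => ω.sto m) = fun m : a.byz => ω'.sto m :=
      funext fun m => hsto m m.2
    have h2 : (fun m : a.byz => ω.msk m) = fun m : a.byz => ω'.msk m :=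
      funext fun m => hmsk m m.2
    rw [Scheme.answers, Scheme.answers, dif_pos hn, dif_pos hn, hgam, hqry, h1, h2]
  · rw [Scheme.answers, Scheme.answers, dif_neg hn, dif_neg hn, hans hn]

/-! ### Shamir shares and the aligned inner-product polynomial. -/

section Shares

open Polynomial

variable {F : Type} [Field F] {N L K B : ℕ}

/-- The polynomial of degree less than `m` with the given coefficients. -/
def coeffPoly {m : ℕ} (r : Fin m → F) : F[X] := ((degreeLTEquiv F m).symm r : F[X])

theorem coeffPoly_add {m : ℕ} (r r' : Fin m → F) :
    coeffPoly (r + r') = coeffPoly r + coeffPoly r' := by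
  simp [coeffPoly]

theorem degree_coeffPoly_lt {m : ℕ} (r : Fin m → F) : (coeffPoly r).degree < m :=
  mem_degreeLT.1 ((degreeLTEquiv F m).symm r).2

theorem exists_coeffPoly_eq {m : ℕ} {P : F[X]} (hP : P.degree < m) :
    ∃ r : Fin m → F, coeffPoly r = P :=
  ⟨degreeLTEquiv F m ⟨P, mem_degreeLT.2 hP⟩, by simp [coeffPoly]⟩

/-- Shamir polynomials of degree at most `B` whose value at `f l` is the secret `v l k`. -/
def share (f : Fin L → F) (v : Fin L → Fin K → F) (r : Fin L → Fin K → Fin B → F) (l : Fin L)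
    (k : Fin K) : F[X] := C (v l k) + (X - C (f l)) * coeffPoly (r l k)

theorem eval_share_self (f : Fin L → F) (v : Fin L → Fin K → F) (r : Fin L → Fin K → Fin B → F)
    (l : Fin L) (k : Fin K) : (share f v r l k).eval (f l) = v l k := by
  simp [share]

theorem share_add (f : Fin L → F) (v v' : Fin L → Fin K → F) (r r' : Fin L → Fin K → Fin B → F)
    (l : Fin L) (k : Fin K) :
    share f (v + v') (r + r') l k = share f v r l k + share f v' r' l k := by
  simp only [share, Pi.add_apply, coeffPoly_add, C_add]
  ring

theorem natDegree_share_le (f : Fin L → F) (v : Fin L → Fin K → F)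
    (r : Fin L → Fin K → Fin B → F) (l : Fin L) (k : Fin K) :
    (share f v r l k).natDegree ≤ B := by
  refine natDegree_le_iff_degree_le.2 ?_
  refine (degree_add_le _ _).trans (max_le (degree_C_le.trans (by positivity)) ?_)
  rw [degree_mul, degree_X_sub_C]
  have h := degree_coeffPoly_lt (r l k)
  by_cases h0 : coeffPoly (r l k) = 0
  · simp [h0]
  · rw [degree_eq_natDegree h0] at h ⊢
    norm_cast at h ⊢
    omega

/-- At most `B` points leave enough freedom in a polynomial of degree below `B` to cancel the secret
at all of them, because no `α n` is a node. -/
theorem exists_share_eval_eq_zero {α : Fin N → F} {f : Fin L → F} (hα : Function.Injective α)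
    (hαf : ∀ n l, α n ≠ f l) (b : Finset (Fin N)) (hb : b.card ≤ B) (v : Fin L → Fin K → F) :
    ∃ r : Fin L → Fin K → Fin B → F, ∀ n ∈ b, ∀ l k, (share f v r l k).eval (α n) = 0 := by
  have : ∀ l k, ∃ r : Fin B → F, ∀ n ∈ b, (coeffPoly r).eval (α n) = -(v l k) / (α n - f l) := by
    intro l k
    obtain ⟨r, hr⟩ := exists_coeffPoly_eq (m := B)
      (P := Lagrange.interpolate b α fun n => -(v l k) / (α n - f l))
      ((Lagrange.degree_interpolate_lt _ hα.injOn).trans_le (by exact_mod_cast hb))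
    exact ⟨r, fun n hn => by rw [hr, Lagrange.eval_interpolate_at_node _ hα.injOn hn]⟩
  choose r hr using this
  refine ⟨r, fun n hn l k => ?_⟩
  have := sub_ne_zero.2 (hαf n l)
  simp only [share, eval_add, eval_C, eval_mul, eval_sub, eval_X, hr l k n hn]
  field_simp
  ring

/-- The polynomial whose value at `f l` is the inner product of the secrets of `s l` and `q l`. -/
def innerPoly (f : Fin L → F) (s q : Fin L → Fin K → F[X]) : F[X] :=
  ∑ l, Lagrange.basis Finset.univ f l * ∑ k, s l k * q l k

theorem eval_innerPoly_self {f : Fin L → F} (hf : Function.Injective f)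
    (s q : Fin L → Fin K → F[X]) (l : Fin L) :
    (innerPoly f s q).eval (f l) = ∑ k, (s l k).eval (f l) * (q l k).eval (f l) := by
  rw [innerPoly, eval_finsetSum, Finset.sum_eq_single l]
  · rw [eval_mul, Lagrange.eval_basis_self hf.injOn (Finset.mem_univ _), one_mul, eval_finsetSum]
    simp only [eval_mul]
  · intro l' _ h
    rw [eval_mul, Lagrange.eval_basis_of_ne h (Finset.mem_univ _), zero_mul]
  · simp

/-- Basis polynomials contribute `L - 1` and products of two shares at most `2B`. -/
theorem degree_innerPoly_lt {f : Fin L → F} (hf : Function.Injective f)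
    {s q : Fin L → Fin K → F[X]} (hs : ∀ l k, (s l k).natDegree ≤ B)
    (hq : ∀ l k, (q l k).natDegree ≤ B) : (innerPoly f s q).degree < ((L + 2 * B : ℕ) : WithBot ℕ) := by
  refine (degree_sum_le _ _).trans_lt ((Finset.sup_lt_iff (WithBot.bot_lt_coe _)).2 fun l _ => ?_)
  have h1 : (∑ k, s l k * q l k).natDegree ≤ 2 * B :=
    natDegree_sum_le_of_forall_le _ _ fun k _ =>
      natDegree_mul_le.trans (by linarith [hs l k, hq l k])
  have hL : 0 < L := l.pos
  have h2 : (Lagrange.basis Finset.univ f l).natDegree = L - 1 := by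
    rw [Lagrange.natDegree_basis hf.injOn (Finset.mem_univ _)]; simp
  refine degree_le_natDegree.trans_lt ?_
  have := natDegree_mul_le (p := Lagrange.basis Finset.univ f l) (q := ∑ k, s l k * q l k)
  exact_mod_cast (by omega)

theorem innerPoly_add_left (f : Fin L → F) (s s' q : Fin L → Fin K → F[X]) :
    innerPoly f (fun l k => s l k + s' l k) q = innerPoly f s q + innerPoly f s' q := by
  simp only [innerPoly, add_mul, Finset.sum_add_distrib, mul_add]

/-- The polynomial that a mask hides is divisible by the nodal polynomial. -/
theorem exists_nodal_mul_coeffPoly_eq {f : Fin L → F} (hf : Function.Injective f) {m : ℕ} {D : F[X]}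
    (hD : D.degree < ((L + m : ℕ) : WithBot ℕ)) (h0 : ∀ l, D.eval (f l) = 0) :
    ∃ z : Fin m → F, Lagrange.nodal Finset.univ f * coeffPoly z = D := by
  have hdvd : Lagrange.nodal Finset.univ f ∣ D :=
    Finset.prod_dvd_of_coprime (fun l _ l' _ h => pairwise_coprime_X_sub_C hf h)
      fun l _ => dvd_iff_isRoot.2 (h0 l)
  obtain ⟨E, rfl⟩ := hdvd
  rw [degree_mul, Lagrange.degree_nodal, Finset.card_univ, Fintype.card_fin, Nat.cast_add] at hD
  obtain ⟨z, hz⟩ := exists_coeffPoly_eq (lt_of_add_lt_add_left hD)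
  exact ⟨z, by rw [hz]⟩

end Shares

/-! ### The masked scheme: correctness, privacy and download. -/

section Construction

open Polynomial

variable {F : Type} [Field F] {N L : ℕ} (α : Fin N → F) (f : Fin L → F)

/-- The masked inner product of two families of shares. -/
def maskedAnswer {K : ℕ} (n : Fin N) (s q : Fin L → Fin K → F) (z : F) : F :=
  ∑ l, (Lagrange.basis Finset.univ f l).eval (α n) * ∑ k, s l k * q l k +
    (Lagrange.nodal Finset.univ f).eval (α n) * z

theorem maskedAnswer_eq {K m : ℕ} (n : Fin N) (s q : Fin L → Fin K → F[X]) (z : Fin m → F) :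
    maskedAnswer α f n (fun l k => (s l k).eval (α n)) (fun l k => (q l k).eval (α n))
      ((coeffPoly z).eval (α n)) =
    (innerPoly f s q + Lagrange.nodal Finset.univ f * coeffPoly z).eval (α n) := by
  simp [maskedAnswer, innerPoly, eval_finsetSum]

/-- The word `w` is a possible message in view of the received answers `y`: up to `B` errors, these
are the values of a polynomial of degree less than `L + 2B` with values `w` at the nodes `f`. -/
def Explains (B : ℕ) (y : Fin N → F) (w : Fin L → F) : Prop :=
  ∃ (P : F[X]) (E : Finset (Fin N)), P.degree < ((L + 2 * B : ℕ) : WithBot ℕ) ∧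
    (∀ l, P.eval (f l) = w l) ∧ E.card ≤ B ∧ ∀ n ∉ E, P.eval (α n) = y n

variable {α f}

/-- Two explanations agree at the `N - 2B ≥ L + 2B` or more servers outside both error sets, which
exceeds both degrees. -/
theorem Explains.unique {B : ℕ} (hα : Function.Injective α) (hN : L + 4 * B ≤ N) {y : Fin N → F}
    {w w' : Fin L → F} (h : Explains α f B y w) (h' : Explains α f B y w') : w = w' := by
  obtain ⟨P, E, hP, hw, hE, hy⟩ := h
  obtain ⟨P', E', hP', hw', hE', hy'⟩ := h'
  have hcard : L + 2 * B ≤ ((E ∪ E')ᶜ).card := by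
    rw [Finset.card_compl, Fintype.card_fin]
    have := Finset.card_union_le E E'
    omega
  have hcard' : ((L + 2 * B : ℕ) : WithBot ℕ) ≤ (((E ∪ E')ᶜ).card : WithBot ℕ) := by
    exact_mod_cast hcard
  have : P = P' := Polynomial.eq_of_degrees_lt_of_eval_index_eq (E ∪ E')ᶜ hα.injOn
    (hP.trans_le hcard') (hP'.trans_le hcard') fun n hn => by
      rw [Finset.mem_compl, Finset.mem_union, not_or] at hn
      rw [hy n hn.1, hy' n hn.2]
  funext l
  rw [← hw, ← hw', this]

variable {K B : ℕ}

/-- The storages as a function of the randomness. -/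
def storages (α : Fin N → F) (f : Fin L → F) (w : Fin K → Fin L → F) (r : Fin L → Fin K → Fin B → F) (n : Fin N) (l : Fin L)
    (k : Fin K) : F := (share f (fun l k => w k l) r l k).eval (α n)

/-- The queries as a function of the randomness. -/
def queries (α : Fin N → F) (f : Fin L → F) (θ : Fin K) (r : Fin L → Fin K → Fin B → F) (n : Fin N) (l : Fin L)
    (k : Fin K) : F := (share f (fun _ k => if k = θ then 1 else 0) r l k).eval (α n)

/-- The masks as a function of the randomness. -/
def masks (α : Fin N → F) (z : Fin (2 * B) → F) (n : Fin N) : F := (coeffPoly z).eval (α n)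

/-- Shares are additive in secret and coins jointly, so a change of messages whose own shares vanish
at a server leaves its storage as it was. -/
theorem storages_add_of_hidden (w δ : Fin K → Fin L → F) (r r₀ : Fin L → Fin K → Fin B → F)
    (n : Fin N) (h : ∀ l k, (share f (fun l k => δ k l) r₀ l k).eval (α n) = 0) :
    storages α f (w + δ) (r + r₀) n = storages α f w r n := by
  funext l k
  have := share_add f (fun l k => w k l) (fun l k => δ k l) r r₀ l k
  calc storages α f (w + δ) (r + r₀) n l k
      = (share f ((fun l k => w k l) + fun l k => δ k l) (r + r₀) l k).eval (α n) := rfl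
    _ = storages α f w r n l k := by rw [this, eval_add, h, add_zero]; rfl

variable (α f) [Fintype F]

open Classical in
/-- The cross-subspace-alignment scheme with masked answers, over the field `F`. -/
def alignedScheme (hL : 0 < L) (K B : ℕ) : Scheme N K where
  Symb := F
  L := L
  L_pos := hL
  Sto _ := Fin L → Fin K → F
  Msk _ := F
  Qry _ := Fin L → Fin K → F
  Ans _ := F
  stoLaw w := (PMF.uniformOfFintype (Fin L → Fin K → Fin B → F)).map fun r n l k =>
    (share f (fun l k => w k l) r l k).eval (α n)
  mskLaw := (PMF.uniformOfFintype (Fin (2 * B) → F)).map fun z n => (coeffPoly z).eval (α n)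
  qryLaw θ := (PMF.uniformOfFintype (Fin L → Fin K → Fin B → F)).map fun r n l k =>
    (share f (fun _ k => if k = θ then 1 else 0) r l k).eval (α n)
  answer := maskedAnswer α f
  decode _ _ y := if h : ∃ w, Explains α f B y w then h.choose else 0

/-- The randomness of the messages, the storages, the queries and the masks. -/
abbrev Coins (F : Type) (L K B : ℕ) : Type :=
  (Fin K → Fin L → F) × (Fin L → Fin K → Fin B → F) × (Fin L → Fin K → Fin B → F) ×
    (Fin (2 * B) → F)

variable {hL : 0 < L}

/-- The outcome as a function of the randomness. -/
def coinOutcome (hL : 0 < L) (θ : Fin K) {G : Type} (c : Coins F L K B) (g : G) :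
    Outcome (alignedScheme α f hL K B) G where
  msg := c.1
  sto := storages α f c.1 c.2.1
  msk := masks α c.2.2.2
  qry := queries α f θ c.2.2.1
  gam := g

theorem alignedScheme_storageJoint : (alignedScheme α f hL K B).storageJoint =
    (PMF.uniformOfFintype ((Fin K → Fin L → F) × (Fin L → Fin K → Fin B → F))).bind fun c =>
      (PMF.pure ()).map fun _ => (c.1, storages α f c.1 c.2) := by
  simp only [PMF.pure_map]
  refine Eq.trans ?_ (uniform_bind_prod fun w r => PMF.pure (w, storages α f w r))
  refine congrArg (PMF.bind _) (funext fun w => ?_)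
  exact PMF.map_comp _ _ _

theorem alignedScheme_queryJoint [NeZero K] : (alignedScheme α f hL K B).queryJoint =
    (PMF.uniformOfFintype (Fin K × (Fin L → Fin K → Fin B → F))).bind fun c =>
      (PMF.pure ()).map fun _ => (c.1, queries α f c.1 c.2) := by
  simp only [PMF.pure_map]
  refine Eq.trans ?_ (uniform_bind_prod fun θ r => PMF.pure (θ, queries α f θ r))
  refine congrArg (PMF.bind _) (funext fun θ => ?_)
  exact PMF.map_comp _ _ _

theorem alignedScheme_law (θ : Fin K) (a : Adversary (alignedScheme α f hL K B) B) :
    (alignedScheme α f hL K B).law θ a =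
      (PMF.uniformOfFintype (Coins F L K B)).bind fun c =>
        a.gamLaw.map (coinOutcome α f hL θ c) := by
  refine (PMF.bind_bind _ _ _).trans (Eq.trans ?_
    (uniform_bind_prod fun w c => a.gamLaw.map (coinOutcome α f hL θ (w, c))))
  refine congrArg (PMF.bind _) (funext fun w => ?_)
  refine (PMF.bind_map _ _ _).trans ((PMF.bind_map _ _ _).trans (Eq.trans ?_
    (uniform_bind_prod fun r c => a.gamLaw.map (coinOutcome α f hL θ (w, r, c)))))
  refine congrArg (PMF.bind _) (funext fun r => ?_)
  -- The law draws the masks before the queries, whereas `Coins` lists the query coins first.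
  refine (PMF.bind_comm _ _ _).trans (Eq.trans ?_
    (uniform_bind_prod fun r' z => a.gamLaw.map (coinOutcome α f hL θ (w, r, r', z))))
  refine (PMF.bind_map _ _ _).trans (congrArg (PMF.bind _) (funext fun r' => ?_))
  exact PMF.bind_map _ _ _

theorem mem_support_alignedScheme_law {θ : Fin K} {a : Adversary (alignedScheme α f hL K B) B}
    {ω : Outcome (alignedScheme α f hL K B) a.Gam}
    (hω : ω ∈ ((alignedScheme α f hL K B).law θ a).support) :
    ∃ c g, ω = coinOutcome α f hL θ c g := by
  rw [alignedScheme_law, PMF.mem_support_bind_iff] at hω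
  obtain ⟨c, -, hc⟩ := hω
  rw [PMF.mem_support_map_iff] at hc
  obtain ⟨g, -, rfl⟩ := hc
  exact ⟨c, g, rfl⟩

theorem coinOutcome_answer (θ : Fin K) {G : Type} (c : Coins F L K B) (g : G) (n : Fin N) :
    (alignedScheme α f hL K B).answer n ((coinOutcome α f hL θ c g).sto n)
      ((coinOutcome α f hL θ c g).qry n) ((coinOutcome α f hL θ c g).msk n) =
    (innerPoly f (share f (fun l k => c.1 k l) c.2.1)
      (share f (fun _ k => if k = θ then 1 else 0) c.2.2.1) +
      Lagrange.nodal Finset.univ f * coeffPoly c.2.2.2).eval (α n) :=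
  maskedAnswer_eq α f n _ _ _

variable {α f}

theorem alignedScheme_correct (hα : Function.Injective α) (hf : Function.Injective f)
    (hN : L + 4 * B ≤ N) : (alignedScheme α f hL K B).Correct B := by
  classical
  intro θ a ω hω
  obtain ⟨c, g, rfl⟩ := mem_support_alignedScheme_law α f hω
  have h : Explains α f B ((alignedScheme α f hL K B).answers a (coinOutcome α f hL θ c g))
      (c.1 θ) := by
    refine ⟨innerPoly f (share f (fun l k => c.1 k l) c.2.1)
      (share f (fun _ k => if k = θ then 1 else 0) c.2.2.1) +
      Lagrange.nodal Finset.univ f * coeffPoly c.2.2.2, a.byz, ?_, ?_, a.card_le, fun n hn => ?_⟩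
    rotate_left 2
    · rw [Scheme.answers, dif_neg hn]
      exact (coinOutcome_answer α f θ c g n).symm
    · refine (degree_add_le _ _).trans_lt (max_lt (degree_innerPoly_lt hf
        (natDegree_share_le _ _ _) (natDegree_share_le _ _ _)) ?_)
      rw [degree_mul, Lagrange.degree_nodal, Finset.card_univ, Fintype.card_fin, Nat.cast_add]
      exact WithBot.add_lt_add_left (WithBot.natCast_ne_bot L) (degree_coeffPoly_lt _)
    -- At the node `f l` the mask vanishes and the query polynomials form the unit vector at `θ`,
    -- which selects one symbol of `W_θ`.
    · intro l
      rw [eval_add, eval_innerPoly_self hf, eval_mul,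
        Lagrange.eval_nodal_at_node (Finset.mem_univ _)]
      simp [eval_share_self]
  have h' : ∃ w, Explains α f B
      ((alignedScheme α f hL K B).answers a (coinOutcome α f hL θ c g)) w := ⟨_, h⟩
  exact (dif_pos h').trans (h'.choose_spec.unique hα hN h)

/-- Shifting the messages by `x' - x` and the storage coins by a compensating `r₀` is an injection
that the servers of `b` cannot see. -/
theorem alignedScheme_storageSecure (hα : Function.Injective α) (hαf : ∀ n l, α n ≠ f l) :
    (alignedScheme α f hL K B).StorageSecure B := by
  intro b hb
  rw [mutualInfo_eq_zero_iff, alignedScheme_storageJoint]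
  refine (independent_of_injections (A := (Fin K → Fin L → F) × (Fin L → Fin K → Fin B → F)) _
    (fun c _ => (c.1, storages α f c.1 c.2)) _ _
    (fun c => c.1) (fun _ _ => rfl) fun (x x' : Fin K → Fin L → F) => ?_).symm
  obtain ⟨r₀, hr₀⟩ := exists_share_eval_eq_zero hα hαf b hb fun l k => (x' - x) k l
  refine ⟨fun c => (c.1 + (x' - x), c.2 + r₀), fun c c' h => ?_, fun c hc => ⟨?_, fun _ => ?_⟩⟩
  · simpa [Prod.ext_iff] using h
  · dsimp only at hc ⊢; rw [hc]; exact add_sub_cancel _ _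
  · funext n
    exact storages_add_of_hidden _ _ _ _ n.1 (hr₀ n n.2)

theorem alignedScheme_byzantineSecure (hα : Function.Injective α) (hαf : ∀ n l, α n ≠ f l) :
    (alignedScheme α f hL K B).ByzantineSecure B := by
  intro θ a
  rw [mutualInfo_eq_zero_iff, alignedScheme_law]
  refine (independent_of_injections (A := Coins F L K B) _
    (coinOutcome α f hL θ) _ _
    (fun c => c.1) (fun _ _ => rfl) fun (x x' : Fin K → Fin L → F) => ?_).symm
  obtain ⟨r₀, hr₀⟩ := exists_share_eval_eq_zero hα hαf a.byz a.card_le fun l k => (x' - x) k l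
  refine ⟨fun c => (c.1 + (x' - x), c.2.1 + r₀, c.2.2), fun c c' h => ?_,
    fun c hc => ⟨?_, fun g => ?_⟩⟩
  · simpa [Prod.ext_iff] using h
  · dsimp only at hc ⊢; rw [hc]; exact add_sub_cancel _ _
  · funext n
    exact answers_congr a (coinOutcome α f hL θ (c.1 + (x' - x), c.2.1 + r₀, c.2.2) g)
      (coinOutcome α f hL θ c g) rfl rfl
      (fun m hm => storages_add_of_hidden c.1 (x' - x) c.2.1 r₀ m (hr₀ m hm)) (fun _ _ => rfl) n
      fun h => absurd n.2 h

theorem alignedScheme_userPrivate [NeZero K] (hα : Function.Injective α)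
    (hαf : ∀ n l, α n ≠ f l) : (alignedScheme α f hL K B).UserPrivate B := by
  classical
  intro b hb
  rw [mutualInfo_eq_zero_iff, alignedScheme_queryJoint]
  refine (independent_of_injections (A := Fin K × (Fin L → Fin K → Fin B → F)) _
    (fun c _ => (c.1, queries α f c.1 c.2)) _ _
    (fun c => c.1) (fun _ _ => rfl) fun (x x' : Fin K) => ?_).symm
  obtain ⟨r₀, hr₀⟩ := exists_share_eval_eq_zero hα hαf b hb
    ((fun _ k => if k = x' then 1 else 0) - fun (_ : Fin L) k => if k = x then (1 : F) else 0)
  -- Only `x ↦ x'` matters; the swap makes the map injective on all indices.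
  refine ⟨fun c => (Equiv.swap x x' c.1, c.2 + r₀), fun c c' h => ?_,
    fun c hc => ⟨?_, fun _ => ?_⟩⟩
  · simpa [Prod.ext_iff] using h
  · dsimp only at hc ⊢; rw [hc, Equiv.swap_apply_left]
  · have hc : c.1 = x := hc
    funext n l k
    have h := share_add f (fun _ k => if k = x then 1 else 0)
      ((fun _ k => if k = x' then 1 else 0) - fun (_ : Fin L) k => if k = x then (1 : F) else 0)
      c.2 r₀ l k
    rw [add_sub_cancel] at h
    show queries α f (Equiv.swap x x' c.1) (c.2 + r₀) n l k = queries α f c.1 c.2 n l k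
    rw [hc, Equiv.swap_apply_left, queries, queries, h, eval_add, hr₀ n n.2, add_zero]

/-- A change `δ` of the undesired messages alters the answer polynomial by one that vanishes at
every node, hence by a multiple of the nodal polynomial, which the mask absorbs. The coalition's
masks stay fixed because its shares of `δ` are zero and the nodal polynomial is nonzero at its
points. -/
theorem alignedScheme_symmetricPrivate (hα : Function.Injective α) (hf : Function.Injective f)
    (hαf : ∀ n l, α n ≠ f l) : (alignedScheme α f hL K B).SymmetricPrivate B := by
  classical
  intro θ a
  rw [mutualInfo_eq_zero_iff, alignedScheme_law]
  refine independent_of_injections (A := Coins F L K B) _ (coinOutcome α f hL θ) _ _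
    (fun c => fun k : {k : Fin K // k ≠ θ} => c.1 k)
    (fun _ _ => rfl) fun (x x' : {k : Fin K // k ≠ θ} → Fin L → F) => ?_
  let δ : Fin K → Fin L → F := fun k => if h : k ≠ θ then x' ⟨k, h⟩ - x ⟨k, h⟩ else 0
  obtain ⟨r₀, hr₀⟩ := exists_share_eval_eq_zero hα hαf a.byz a.card_le fun l k => δ k l
  have hz : ∀ r : Fin L → Fin K → Fin B → F, ∃ z : Fin (2 * B) → F,
      Lagrange.nodal Finset.univ f * coeffPoly z =
        -innerPoly f (share f (fun l k => δ k l) r₀)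
          (share f (fun _ k => if k = θ then 1 else 0) r) := by
    intro r
    refine exists_nodal_mul_coeffPoly_eq hf ?_ fun l => ?_
    · rw [degree_neg]
      exact degree_innerPoly_lt hf (natDegree_share_le _ _ _) (natDegree_share_le _ _ _)
    · rw [eval_neg, eval_innerPoly_self hf]
      simp [eval_share_self, δ]
  choose z₀ hz₀ using hz
  have hmask : ∀ r, ∀ n ∈ a.byz, (coeffPoly (z₀ r)).eval (α n) = 0 := by
    intro r n hn
    have h := congrArg (eval (α n)) (hz₀ r)
    rw [eval_mul, eval_neg, innerPoly, eval_finsetSum, Finset.sum_eq_zero, neg_zero] at h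
    · exact (mul_eq_zero.1 h).resolve_left
        (Lagrange.eval_nodal_not_at_node fun l _ => hαf n l)
    · intro l _
      rw [eval_mul, eval_finsetSum, Finset.sum_eq_zero, mul_zero]
      intro k _
      rw [eval_mul, hr₀ n hn, zero_mul]
  refine ⟨fun c => (c.1 + δ, c.2.1 + r₀, c.2.2.1, c.2.2.2 + z₀ c.2.2.1), fun c c' h => ?_,
    fun c hc => ⟨?_, fun g => ?_⟩⟩
  -- The mask correction depends only on the query coins, which the map fixes, so the map is
  -- injective.
  · simp only [Prod.mk.injEq, add_left_inj] at h
    obtain ⟨h1, h2, h3, h4⟩ := h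
    rw [h3, add_left_inj] at h4
    exact Prod.ext h1 (Prod.ext h2 (Prod.ext h3 h4))
  · funext k
    have hk : c.1 k = x k := congrFun hc k
    show c.1 k + δ k = x' k
    simp [δ, k.2, hk]
  · refine Prod.ext (funext fun n => ?_) rfl
    refine answers_congr a
      (coinOutcome α f hL θ (c.1 + δ, c.2.1 + r₀, c.2.2.1, c.2.2.2 + z₀ c.2.2.1) g)
      (coinOutcome α f hL θ c g) rfl rfl
      (fun m hm => storages_add_of_hidden c.1 δ c.2.1 r₀ m (hr₀ m hm)) (fun m hm => ?_) n fun _ => ?_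
    · show (coeffPoly (c.2.2.2 + z₀ c.2.2.1)).eval (α m) = (coeffPoly c.2.2.2).eval (α m)
      rw [coeffPoly_add, eval_add, hmask _ m hm, add_zero]
    · refine (coinOutcome_answer α f θ _ g n).trans
        (Eq.trans ?_ (coinOutcome_answer α f θ c g n).symm)
      refine congrArg (eval (α n)) ?_
      have h : share f (fun l k => (c.1 + δ) k l) (c.2.1 + r₀) = fun l k =>
          share f (fun l k => c.1 k l) c.2.1 l k + share f (fun l k => δ k l) r₀ l k :=
        funext fun l => funext fun k => share_add f (fun l k => c.1 k l) (fun l k => δ k l) _ _ l k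
      rw [h, innerPoly_add_left, coeffPoly_add, mul_add, hz₀]
      abel

/-- Each answer, forged or not, is a single field element. -/
theorem alignedScheme_download_le (θ : Fin K) (a : Adversary (alignedScheme α f hL K B) B) :
    (alignedScheme α f hL K B).download θ a ≤ N := by
  have hlog : 0 < log (Fintype.card F) := log_pos (by exact_mod_cast Fintype.one_lt_card)
  refine (div_le_iff₀ hlog).2 ?_
  refine (Finset.sum_le_sum fun n _ => entropy_le_log_card _ _).trans_eq ?_
  show ∑ _n : Fin N, log (Fintype.card F : ℝ) = N * log (Fintype.card F)
  simp

end Construction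

/-! ### Achievability and the capacity. -/

theorem achievable_of_lt {N B K : ℕ} [NeZero K] (hB : 4 * B < N) :
    Achievable N B K (Real.toNNReal (1 - 4 * (B : ℝ) / N)) := by
  -- The field must contain `N` evaluation points and `N - 4B` nodes, all distinct.
  obtain ⟨p, hp, hprime⟩ := Nat.exists_infinite_primes (N + (N - 4 * B))
  have : Fact p.Prime := ⟨hprime⟩
  obtain ⟨e⟩ : Nonempty (Fin N ⊕ Fin (N - 4 * B) ↪ ZMod p) :=
    Function.Embedding.nonempty_of_card_le (by simpa [ZMod.card] using hp)
  have hα : Function.Injective fun n => e (Sum.inl n) := e.injective.comp Sum.inl_injective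
  have hf : Function.Injective fun l => e (Sum.inr l) := e.injective.comp Sum.inr_injective
  have hαf : ∀ n l, e (Sum.inl n) ≠ e (Sum.inr l) := fun n l h => Sum.inl_ne_inr (e.injective h)
  have hL : 0 < N - 4 * B := by omega
  refine ⟨alignedScheme (fun n => e (Sum.inl n)) (fun l => e (Sum.inr l)) hL K B,
    ⟨alignedScheme_correct hα hf (by omega), alignedScheme_storageSecure hα hαf,
      alignedScheme_byzantineSecure hα hαf, alignedScheme_userPrivate hα hαf,
      alignedScheme_symmetricPrivate hα hf hαf⟩, fun θ a => ?_⟩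
  have hN : (0 : ℝ) < N := by exact_mod_cast (by omega : 0 < N)
  have hB' : 4 * (B : ℝ) < N := by exact_mod_cast hB
  have hR : 0 ≤ 1 - 4 * (B : ℝ) / N := by
    rw [sub_nonneg, div_le_one hN]
    exact hB'.le
  rw [Real.coe_toNNReal _ hR]
  refine (mul_le_mul_of_nonneg_left (alignedScheme_download_le θ a) hR).trans_eq ?_
  show (1 - 4 * (B : ℝ) / N) * N = ((N - 4 * B : ℕ) : ℝ)
  rw [Nat.cast_sub hB.le, sub_mul, div_mul_cancel₀ _ hN.ne']
  push_cast
  ring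

/-- With at least two messages, the capacity is exactly `1 - 4B/N`. -/
theorem capacity_eq {N B K : ℕ} [NeZero K] (hN : 0 < N) (hB : 4 * B ≤ N) (hK : 1 < K) :
    capacity N B K = ENNReal.ofReal (1 - 4 * (B : ℝ) / N) := by
  refine le_antisymm (iSup₂_le fun R hR => ?_) ?_
  · rw [← ENNReal.ofReal_coe_nnreal]
    exact ENNReal.ofReal_le_ofReal (hR.le hN hB hK)
  -- If `4B = N` the scheme would have `L = 0`, but the claimed capacity is then `0` and nothing has
  -- to be achieved.
  · rcases hB.lt_or_eq with h | h
    · exact le_iSup₂_of_le _ (achievable_of_lt h) le_rfl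
    · have hN' : (N : ℝ) ≠ 0 := by exact_mod_cast hN.ne'
      have : (4 * B : ℝ) = N := by exact_mod_cast h
      rw [this, div_self hN', sub_self, ENNReal.ofReal_zero]
      exact zero_le

end BSPIR

/-- As the number `K + 1` of messages tends to infinity, the capacity tends to `1 - 4B/N`. -/
theorem theorem1 (N B : ℕ) (hN : 0 < N) (hB : 4 * B ≤ N) :
    Tendsto (fun K : ℕ => BSPIR.capacity N B (K + 1)) atTop
      (𝓝 (ENNReal.ofReal (1 - 4 * (B : ℝ) / (N : ℝ)))) := by
  refine tendsto_const_nhds.congr' ?_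
  -- There are `K + 1` messages, so `K ≥ 1` provides the second message that the converse needs.
  filter_upwards [eventually_ge_atTop 1] with K hK
  exact (BSPIR.capacity_eq hN hB (by omega)).symm

end
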